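/- **Setting.** For $n\ge -1$ let $[n]=\{0,\dots,n\}$, and let $\Delta_{\mathrm{inj}*}$ be the category of the ordinals $[n]$, $n\geq -1$, and order-preserving injections. A locally finite span $X\leftarrow Q\to Y$ of sets is a pair of maps (source, target) such that the source map has finite fibres; spans are composed by fibre product, and 2-morphisms between spans are fibrewise bijections. An *augmented semi-simplicial object in the Burnside 2-category* $X_\bullet$ is a strictly unital pseudo-functor from $\Delta_{\mathrm{inj}*}^{\mathrm{op}}$ to this 2-category: sets $X_n$ ($n\ge -1$); for each $U\subseteq[n]$ a locally finite span $\partial_U$ from $X_n$ to $X_{n-|U|}$ (the image of the injection $[n-|U|]\to[n]$ that misses $U$; the middle set is also written $\partial_U$); and, for disjoint $V,W\subseteq [n]$, fibrewise bijections $\mu_{V,W}\colon\partial_{V\cup W}\to\partial_{\psi_V(W)}\circ\partial_V$, where $\psi_V(W)=\{w-|\{v\in V: v<w\}| : w\in W\}$; such that $\partial_\emptyset$ is the identity span, $\mu_{\emptyset,V}$ and $\mu_{V,\emptyset}$ are identities, and $(\mathrm{Id}\times\mu_{\psi_{V_1}(V_2),\psi_{V_1}(V_3)})\circ\mu_{V_1,V_2\cup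 V_3}=(\mu_{V_1,V_2}\times\mathrm{Id})\circ\mu_{V_1\cup V_2,V_3}$. It is *ordered* if each set $\partial_U$ carries a total order. For $V\subseteq U$ let $\lambda_V\colon\partial_U\to\partial_V$ be $\mu_{V,U\smallsetminus V}$ followed by the projection, and for disjoint $V,W\subseteq U$ let $\lambda_{V,W}\colon\partial_U\to\partial_{\psi_V(W)}$ be the middle component of $(\mu_{V,W}\times\mathrm{Id})\circ\mu_{V\cup W,U\smallsetminus(V\cup W)}$. The $\mathbb F_2$-linearisation of a span from $X$ to $Y$ is the linear map $\mathbb F_2\langle X\rangle\to\mathbb F_2\langle Y\rangle$ that sends $x$ to $\sum_y|\mathrm{source}^{-1}(x)\cap\mathrm{target}^{-1}(y)|\,y$. The chain complex $C_*=C_*(X_\bullet;\mathbb F_2)$ has $C_n=\mathbb F_2\langle X_n\rangle$, and $d\colon C_n\to C_{n-1}$ is the linearisation of $\sum_{i=0}^n\partial_{\{i\}}$ (sums of spans are disjoint unions of the middle sets). **Wedge products.** Let $U,V\subseteq[n]$ and $(s,t)\in\partial_U\times\partial_V$. A pair $(W^{\shortparallel},W^\circ)$ of disjoint subsets of $U\cap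 V$ is *good* if $\lambda_{W^\shortparallel}(s)=\lambda_{W^\shortparallel}(t)$ and $\lambda_{W^\shortparallel,W^\circ}(s)\ne\lambda_{W^\shortparallel,W^\circ}(t)$. A good pair is *positive* if $\lambda_{W^\shortparallel,W^\circ}(s)<\lambda_{W^\shortparallel,W^\circ}(t)$ when $n+|U|+|V|$ is even, and if $\lambda_{W^\shortparallel,W^\circ}(s)>\lambda_{W^\shortparallel,W^\circ}(t)$ when $n+|U|+|V|$ is odd. Write $(W_0^\shortparallel,W_0^\circ)\prec(W_1^\shortparallel,W_1^\circ)$ if $W_1^\circ=W_0^\circ\cup\{w\}$ for some $w\notin W_0^\circ$ and $W_1^\shortparallel=W_0^\shortparallel\smallsetminus\{w\}$. Let $\mathcal O_{s,t}^+$ be the set of chains $W_1\prec\dots\prec W_r$ of length $r=|U\cap V|$ of positive good pairs. The wedge product $\partial_U\wedge\partial_V$ is the span from $X_n\times X_n$ to $X_{n-|U|}\times X_{n-|V|}$ with middle set $\coprod_{(s,t)\in\partial_U\times\partial_V}\mathcal O_{s,t}^+$, in which an element over $(s,t)$ has source $(\mathrm{source}(s),\mathrm{source}(t))$ and target $(\mathrm{target}(s),\mathrm{target}(t))$.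 **Operations.** Let $\mathcal P_q(n)$ be the set of non-decreasing sequences of length $q$ in $[n]$ in which every number appears at most twice (empty for $q<0$). For $U\in\mathcal P_q(n)$ let $\bar U$ be the increasing sequence of the numbers that appear in $U$. Let $U^+$ (resp. $U^-$) be the set of all numbers $u$ that appear twice in $U$, together with those that appear once and for which $u+i$ is even (resp. odd), where $u$ is the $i$-th entry of $\bar U$, $i\geq 1$. Put $$\nabla^{\binom nq}=\sum_{U\in\mathcal P_q(n)}\partial_{U^-}\wedge\partial_{U^+},$$ and for $k\in\mathbb Z$ let $\nabla_k\colon C_*\to C_*\otimes C_*$ be the linearisation of $\sum_n\nabla^{\binom n{n-k}}\circ\Delta_n$, where $\Delta_n\colon X_n\to X_n\times X_n$ is the diagonal and $\mathbb F_2\langle X_a\times X_b\rangle=C_a\otimes C_b$. Let $C^p$ be the dual of $C_p$, let $\delta$ be the dual of $d$, and let $\smile_k\colon C^*\otimes C^*\to C^*$, $(\alpha\smile_k\beta)(c)=(\alpha\otimes\beta)(\nabla_k c)$, be the dual of $\nabla_k$. **Theorem.** Let $X_\bullet$ be an ordered augmented semi-simplicial object in the Burnside 2-category. Then $(C_*,d)$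 is a chain complex, and $\{\nabla_i\}_{i\in\mathbb Z}$ is a stable symmetric comultiplication on it: each $\nabla_i$ has degree $i$, and, with $T(a\otimes b)=b\otimes a$ and $d$ on $C_*\otimes C_*$ given by $d\otimes1+1\otimes d$, $$\nabla_i\circ d=d\circ\nabla_i+(1+T)\circ\nabla_{i-1}\qquad\text{for all } i\in\mathbb Z.$$ Dually, $\{\smile_i\}_{i\in\mathbb Z}$ is a stable symmetric multiplication on the cochain complex $(C^*,\delta)$: $\smile_i$ maps $C^p\otimes C^q$ to $C^{p+q-i}$, and $$\delta(\alpha\smile_i\beta)=\delta\alpha\smile_i\beta+\alpha\smile_i\delta\beta+\alpha\smile_{i-1}\beta+\beta\smile_{i-1}\alpha\qquad\text{for all } i\in\mathbb Z,\ \alpha\in C^p,\ \beta\in C^q.$$ -/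

import Mathlib

open scoped TensorProduct

universe u

/-! ### Locally finite spans of sets -/

/-- A locally finite span `X ⟵ Q ⟶ Y` of sets: every fibre of the source map is finite. -/
structure LFSpan (X Y : Type u) where
  carrier : Type u
  source : carrier → X
  target : carrier → Y
  finite_fiber : ∀ x, (source ⁻¹' {x}).Finite

namespace LFSpan

/-- The identity span `X ⟵ X ⟶ X`. -/
def id (X : Type u) : LFSpan.{u} X X where
  carrier := X
  source := fun x => x
  target := fun x => x
  finite_fiber := fun x => Set.finite_singleton x

/-- The span `X ⟵ X ⟶ Y` given by a function `f : X → Y`. -/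
def ofFun {X Y : Type u} (f : X → Y) : LFSpan.{u} X Y where
  carrier := X
  source := fun x => x
  target := f
  finite_fiber := fun x => Set.finite_singleton x

/-- The composite of the spans `S : X ⟶ Y` and `S' : Y ⟶ Z` (first `S`, then `S'`): the fibre
product over `Y`. -/
def comp {X Y Z : Type u} (S : LFSpan.{u} X Y) (S' : LFSpan.{u} Y Z) :
    LFSpan.{u} X Z where
  carrier := {p : S.carrier × S'.carrier // S.target p.1 = S'.source p.2}
  source := fun p => S.source p.1.1
  target := fun p => S'.target p.1.2
  finite_fiber := by
    intro x
    have h : (⋃ a ∈ S.source ⁻¹' {x}, (Prod.mk a) '' (S'.source ⁻¹' {S.target a})).Finite :=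
      (S.finite_fiber x).biUnion fun a _ => (S'.finite_fiber _).image _
    refine Set.Finite.of_finite_image (f := Subtype.val) (h.subset ?_)
      Subtype.val_injective.injOn
    rintro _ ⟨⟨⟨a, b⟩, hab⟩, hx, rfl⟩
    simp only [Set.mem_iUnion]
    exact ⟨a, hx, b, hab.symm, rfl⟩

/-- A fibrewise bijection between two spans from `X` to `Y`. -/
structure FibBij {X Y : Type u} (S S' : LFSpan.{u} X Y) where
  toEquiv : S.carrier ≃ S'.carrier
  source_comp : ∀ q, S'.source (toEquiv q) = S.source q
  target_comp : ∀ q, S'.target (toEquiv q) = S.target q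

/-- Postcomposition of the target map of a span with a function. -/
def mapTarget {X Y Z : Type u} (S : LFSpan.{u} X Y) (f : Y → Z) :
    LFSpan.{u} X Z where
  carrier := S.carrier
  source := S.source
  target := fun q => f (S.target q)
  finite_fiber := S.finite_fiber

/-- The sum `∑ i, S i` of a finite family of spans from `X` to `Y`: the disjoint union of the
middle sets. -/
def sum {ι : Type} [Finite ι] {X Y : Type u} (S : ι → LFSpan.{u} X Y) :
    LFSpan.{u} X Y where
  carrier := Σ i, (S i).carrier
  source := fun q => (S q.1).source q.2
  target := fun q => (S q.1).target q.2
  finite_fiber := by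
    intro x
    have h : (⋃ i : ι, (Sigma.mk i) '' ((S i).source ⁻¹' {x})).Finite :=
      Set.finite_iUnion fun i => ((S i).finite_fiber x).image _
    refine h.subset ?_
    rintro ⟨i, q⟩ hq
    simp only [Set.mem_iUnion]
    exact ⟨i, q, hq, rfl⟩

/-- The span out of a disjoint union given by a (possibly infinite) family of spans. -/
def sigma {ι : Type} {X : ι → Type u} {Y : Type u} (S : ∀ i, LFSpan.{u} (X i) Y) :
    LFSpan.{u} (Σ i, X i) Y where
  carrier := Σ i, (S i).carrier
  source := fun q => ⟨q.1, (S q.1).source q.2⟩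
  target := fun q => (S q.1).target q.2
  finite_fiber := by
    rintro ⟨i, x⟩
    refine (((S i).finite_fiber x).image (Sigma.mk i)).subset ?_
    rintro ⟨j, q⟩ hq
    have hq' : (⟨j, (S j).source q⟩ : Σ i, X i) = ⟨i, x⟩ := hq
    obtain ⟨rfl, h⟩ := Sigma.mk.inj_iff.1 hq'
    exact ⟨q, eq_of_heq h, rfl⟩

/-- The linearisation over `𝔽₂` of a span from `X` to `Y`: the linear map
`𝔽₂⟨X⟩ → 𝔽₂⟨Y⟩` sending `x` to the sum of `target q` over all `q` with `source q = x`; the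
coefficient of `y` is thus the number of `q` with `source q = x` and `target q = y`. -/
noncomputable def linearise {X Y : Type u} (S : LFSpan.{u} X Y) :
    (X →₀ ZMod 2) →ₗ[ZMod 2] (Y →₀ ZMod 2) :=
  Finsupp.linearCombination (ZMod 2)
    (fun x => ∑ q ∈ (S.finite_fiber x).toFinset, Finsupp.single (S.target q) (1 : ZMod 2))

end LFSpan

/-! ### Face maps of finite ordinals

The ordinal `[n] = {0, …, n}`, `n ≥ -1`, is `Fin m` with `m = n + 1`, and the morphisms of the
augmented semi-simplicial category are the order embeddings `Fin k ↪o Fin m`. -/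

namespace OrdFace

/-- The order embedding of ordinals that misses exactly `U`. -/
def missing {m : ℕ} (U : Finset (Fin m)) {k : ℕ} (h : k + U.card = m) : Fin k ↪o Fin m :=
  Uᶜ.orderEmbOfFin (by rw [Finset.card_compl, Fintype.card_fin]; omega)

theorem sub_add_card {m : ℕ} (U : Finset (Fin m)) : m - U.card + U.card = m :=
  Nat.sub_add_cancel (by simpa using Finset.card_le_univ U)

/-- The generalised face map `∂_U : [n - |U|] → [n]`. -/
def face {m : ℕ} (U : Finset (Fin m)) : Fin (m - U.card) ↪o Fin m :=
  missing U (sub_add_card U)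

/-- For `W` disjoint from `V`, the set `ψ_V(W) = {w - |{v ∈ V | v < w}| : w ∈ W}`, that is, the
inverse image of `W` under the order embedding that misses `V`. -/
def psi {m : ℕ} (V W : Finset (Fin m)) : Finset (Fin (m - V.card)) :=
  Finset.univ.filter fun i => face V i ∈ W

theorem map_psi {m : ℕ} {V W : Finset (Fin m)} (h : Disjoint V W) :
    (psi V W).map (face V).toEmbedding = W := by
  ext w
  simp only [Finset.mem_map, psi, Finset.mem_filter, Finset.mem_univ, true_and]
  constructor
  · rintro ⟨i, hi, rfl⟩
    exact hi
  · intro hw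
    have h1 : w ∈ Set.range (face V) := by
      unfold face missing
      rw [Finset.range_orderEmbOfFin]
      simpa using fun hv => (Finset.disjoint_left.1 h) hv hw
    obtain ⟨i, rfl⟩ := h1
    exact ⟨i, hw, rfl⟩

theorem card_psi {m : ℕ} {V W U : Finset (Fin m)} (h : Disjoint V W) (hU : V ∪ W = U) :
    m - U.card + (psi V W).card = m - V.card := by
  have h1 : (psi V W).card = W.card := by
    conv_rhs => rw [← map_psi h]
    rw [Finset.card_map]
  have h2 : U.card = V.card + W.card := by rw [← hU, Finset.card_union_of_disjoint h]
  have h3 : U.card ≤ m := by simpa using Finset.card_le_univ U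
  omega

/-- The face map `∂_{ψ_V(W)} : [n - |U|] → [n - |V|]`, where `U` is the disjoint union of `V`
and `W`. -/
def relFace {m : ℕ} {V W U : Finset (Fin m)} (h : Disjoint V W) (hU : V ∪ W = U) :
    Fin (m - U.card) ↪o Fin (m - V.card) :=
  missing (psi V W) (card_psi h hU)

/-- The simplicial identity `∂_V ∘ ∂_{ψ_V(W)} = ∂_{V ∪ W}` of order embeddings. -/
theorem relFace_trans {m : ℕ} {V W U : Finset (Fin m)} (h : Disjoint V W) (hU : V ∪ W = U) :
    (relFace h hU).trans (face V) = face U := by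
  apply Finset.orderEmbOfFin_unique'
  intro i
  have h1 : relFace h hU i ∈ (psi V W)ᶜ := Finset.orderEmbOfFin_mem _ _ i
  have h2 : face V (relFace h hU i) ∈ Vᶜ := Finset.orderEmbOfFin_mem _ _ _
  suffices h4 : face V (relFace h hU i) ∉ V ∪ W by
    rw [hU] at h4
    exact Finset.mem_compl.2 h4
  simp only [psi, Finset.mem_compl, Finset.mem_filter, Finset.mem_univ, true_and,
    Finset.mem_union] at h1 h2 ⊢
  exact fun h3 => h3.elim h2 h1

end OrdFace

/-! ### Ordered augmented semi-simplicial objects in the Burnside 2-category -/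

/-- An augmented semi-simplicial object in the Burnside 2-category: a strictly unital
pseudo-functor from the opposite of the category of finite ordinals and order-preserving
injections to the 2-category of sets, locally finite spans and fibrewise bijections.
`obj m` is the set `X_{m-1}` of `(m-1)`-simplices, attached to the ordinal with `m` elements. -/
structure AugSemiSimplicialBurnside where
  obj : ℕ → Type u
  /-- the span from `obj m` to `obj k` attached to an order embedding of ordinals -/
  span : ∀ {k m : ℕ}, (Fin k ↪o Fin m) → LFSpan (obj m) (obj k)
  /-- for every decomposition `h = f ∘ g`, a fibrewise bijection from `span h` to
  the composite of `span f` and `span g` -/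
  mu : ∀ {k l m : ℕ} (f : Fin l ↪o Fin m) (g : Fin k ↪o Fin l) (h : Fin k ↪o Fin m),
    g.trans f = h → LFSpan.FibBij (span h) ((span f).comp (span g))
  /-- identities go to identity spans -/
  span_id : ∀ m : ℕ, span (RelEmbedding.refl (· ≤ ·) : Fin m ↪o Fin m) = LFSpan.id (obj m)
  /-- for the decomposition `f = f ∘ id`, the fibrewise bijection is the identity -/
  mu_id_right : ∀ {k m : ℕ} (f : Fin k ↪o Fin m)
    (e : (RelEmbedding.refl (· ≤ ·) : Fin k ↪o Fin k).trans f = f) (q : (span f).carrier),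
    ((mu f (RelEmbedding.refl (· ≤ ·)) f e).toEquiv q).1.1 = q
  /-- for the decomposition `f = id ∘ f`, the fibrewise bijection is the identity -/
  mu_id_left : ∀ {k m : ℕ} (f : Fin k ↪o Fin m)
    (e : f.trans (RelEmbedding.refl (· ≤ ·) : Fin m ↪o Fin m) = f) (q : (span f).carrier),
    ((mu (RelEmbedding.refl (· ≤ ·)) f f e).toEquiv q).1.2 = q
  /-- for every decomposition `h = f₁ ∘ f₂ ∘ f₃`, the two fibrewise bijections from `span h` to
  the triple composite agree; the three equations compare their three components -/
  mu_assoc : ∀ {j k l m : ℕ} (f₁ : Fin l ↪o Fin m) (f₂ : Fin k ↪o Fin l) (f₃ : Fin j ↪o Fin k)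
    (f₁₂ : Fin k ↪o Fin m) (f₂₃ : Fin j ↪o Fin l) (h : Fin j ↪o Fin m)
    (e₁₂ : f₂.trans f₁ = f₁₂) (e₂₃ : f₃.trans f₂ = f₂₃)
    (e : f₂₃.trans f₁ = h) (e' : f₃.trans f₁₂ = h) (q : (span h).carrier),
    ((mu f₁ f₂₃ h e).toEquiv q).1.1
        = ((mu f₁ f₂ f₁₂ e₁₂).toEquiv ((mu f₁₂ f₃ h e').toEquiv q).1.1).1.1 ∧
    ((mu f₂ f₃ f₂₃ e₂₃).toEquiv ((mu f₁ f₂₃ h e).toEquiv q).1.2).1.1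
        = ((mu f₁ f₂ f₁₂ e₁₂).toEquiv ((mu f₁₂ f₃ h e').toEquiv q).1.1).1.2 ∧
    ((mu f₂ f₃ f₂₃ e₂₃).toEquiv ((mu f₁ f₂₃ h e).toEquiv q).1.2).1.2
        = ((mu f₁₂ f₃ h e').toEquiv q).1.2

/-- An ordered augmented semi-simplicial object in the Burnside 2-category: each span carries a
total order. -/
structure OrderedAugSemiSimplicialBurnside extends AugSemiSimplicialBurnside.{u} where
  order : ∀ {k m : ℕ} (f : Fin k ↪o Fin m), LinearOrder (span f).carrier

/-! ### Non-decreasing sequences with entries repeated at most twice -/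

/-- A non-decreasing sequence of elements of `{0, …, m - 1}` in which every number appears at
most twice, recorded by the multiplicity of each number. -/
abbrev TwiceSeq (m : ℕ) : Type := Fin m → Fin 3

namespace TwiceSeq

variable {m : ℕ}

/-- The length of the sequence. -/
def length (U : TwiceSeq m) : ℕ := ∑ i, (U i : ℕ)

/-- The (increasing) sequence in which one instance of each repeated number is removed. -/
def reduced (U : TwiceSeq m) : Finset (Fin m) := Finset.univ.filter fun u => U u ≠ 0

/-- The index of an entry `u`: the sum of `u` and its position in `U.reduced`, counted from `1`.
A repeated number `u` has the two indices `U.index u` and `U.index u + 1`. -/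
def index (U : TwiceSeq m) (u : Fin m) : ℕ := u + (U.reduced.filter fun v => v ≤ u).card

/-- `U⁺`: the entries of even index (among them all the repeated ones). -/
def plus (U : TwiceSeq m) : Finset (Fin m) :=
  Finset.univ.filter fun u => U u = 2 ∨ (U u = 1 ∧ Even (U.index u))

/-- `U⁻`: the entries of odd index (among them all the repeated ones). -/
def minus (U : TwiceSeq m) : Finset (Fin m) :=
  Finset.univ.filter fun u => U u = 2 ∨ (U u = 1 ∧ Odd (U.index u))

end TwiceSeq

/-! ### Maximal chains of good pairs -/

/-- A pair of disjoint subsets of `A`. -/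
structure DisjPair {m : ℕ} (A : Finset (Fin m)) where
  par : Finset (Fin m)
  circ : Finset (Fin m)
  disj : Disjoint par circ
  par_subset : par ⊆ A
  circ_subset : circ ⊆ A

instance {m : ℕ} (A : Finset (Fin m)) : Finite (DisjPair A) :=
  Finite.of_injective (fun W : DisjPair A => (W.par, W.circ)) (by
    rintro ⟨p, c, _, _, _⟩ ⟨p', c', _, _, _⟩ h
    simpa using h)

namespace DisjPair

variable {m : ℕ} {A : Finset (Fin m)}

/-- `W₀ ≺ W₁`: the second set of `W₁` arises from that of `W₀` by adding an element, and the
first by removing that element if it is there. -/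
def Consecutive (W₀ W₁ : DisjPair A) : Prop :=
  ∃ w, w ∉ W₀.circ ∧ W₁.circ = insert w W₀.circ ∧ W₁.par = W₀.par.erase w

end DisjPair

namespace AugSemiSimplicialBurnside

variable (X : AugSemiSimplicialBurnside.{u})

/-- The generalised face span `∂_U` from `X_n` to `X_{n-|U|}`. -/
abbrev del {m : ℕ} (U : Finset (Fin m)) : LFSpan (X.obj m) (X.obj (m - U.card)) :=
  X.span (OrdFace.face U)

/-- The face span `∂_{ψ_V(W)}` from `X_{n-|V|}` to `X_{n-|V|-|W|}`. -/
abbrev relDel {m : ℕ} {V W : Finset (Fin m)} (h : Disjoint V W) :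
    LFSpan (X.obj (m - V.card)) (X.obj (m - (V ∪ W).card)) :=
  X.span (OrdFace.relFace h rfl)

/-- `λ_V : ∂_U → ∂_V` for `V ⊆ U`: the bijection `μ_{V, U ∖ V}` followed by projection. -/
def lam {m : ℕ} {V U : Finset (Fin m)} (h : V ⊆ U) (s : (X.del U).carrier) :
    (X.del V).carrier :=
  ((X.mu (OrdFace.face V)
    (OrdFace.relFace Finset.disjoint_sdiff (Finset.union_sdiff_of_subset h))
    (OrdFace.face U) (OrdFace.relFace_trans _ _)).toEquiv s).1.1

/-- `λ_{V,W} : ∂_U → ∂_{ψ_V(W)}` for disjoint `V, W ⊆ U`: the middle component of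
`(μ_{V,W} × Id) ∘ μ_{V ∪ W, U ∖ (V ∪ W)}`. -/
def lam₂ {m : ℕ} {V W U : Finset (Fin m)} (hVW : Disjoint V W) (h : V ∪ W ⊆ U)
    (s : (X.del U).carrier) : (X.relDel hVW).carrier :=
  ((X.mu (OrdFace.face V) (OrdFace.relFace hVW rfl) (OrdFace.face (V ∪ W))
    (OrdFace.relFace_trans _ _)).toEquiv (X.lam h s)).1.2

end AugSemiSimplicialBurnside

namespace OrderedAugSemiSimplicialBurnside

variable (X : OrderedAugSemiSimplicialBurnside.{u})

section Good

variable {m : ℕ} {U V : Finset (Fin m)}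

/-- `λ_{W∥}(s)` -/
def parLeft (W : DisjPair (U ∩ V)) (s : (X.del U).carrier) : (X.del W.par).carrier :=
  X.lam (W.par_subset.trans Finset.inter_subset_left) s

/-- `λ_{W∥}(t)` -/
def parRight (W : DisjPair (U ∩ V)) (t : (X.del V).carrier) : (X.del W.par).carrier :=
  X.lam (W.par_subset.trans Finset.inter_subset_right) t

/-- `λ_{W∥,W∘}(s)` -/
def circLeft (W : DisjPair (U ∩ V)) (s : (X.del U).carrier) : (X.relDel W.disj).carrier :=
  X.lam₂ W.disj
    ((Finset.union_subset W.par_subset W.circ_subset).trans Finset.inter_subset_left) s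

/-- `λ_{W∥,W∘}(t)` -/
def circRight (W : DisjPair (U ∩ V)) (t : (X.del V).carrier) : (X.relDel W.disj).carrier :=
  X.lam₂ W.disj
    ((Finset.union_subset W.par_subset W.circ_subset).trans Finset.inter_subset_right) t

/-- The pair `W` is `(s,t)`-good. -/
def IsGood (s : (X.del U).carrier) (t : (X.del V).carrier) (W : DisjPair (U ∩ V)) : Prop :=
  X.parLeft W s = X.parRight W t ∧ X.circLeft W s ≠ X.circRight W t

/-- The good pair `W` is positive: `λ_{W∥,W∘}(s) < λ_{W∥,W∘}(t)` if `n + |U| + |V|` is even and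
`λ_{W∥,W∘}(s) > λ_{W∥,W∘}(t)` if it is odd. Here `n = m - 1`. -/
def IsPositive (s : (X.del U).carrier) (t : (X.del V).carrier) (W : DisjPair (U ∩ V)) : Prop :=
  (Even ((m : ℤ) - 1 + U.card + V.card) ∧
    (X.order (OrdFace.relFace W.disj rfl)).lt (X.circLeft W s) (X.circRight W t)) ∨
  (Odd ((m : ℤ) - 1 + U.card + V.card) ∧
    (X.order (OrdFace.relFace W.disj rfl)).lt (X.circRight W t) (X.circLeft W s))

/-- The set of positive maximal chains `W₁ ≺ … ≺ W_r`, `r = |U ∩ V|`, of `(s,t)`-good pairs. -/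
def PositiveChains (s : (X.del U).carrier) (t : (X.del V).carrier) : Type :=
  {W : Fin (U ∩ V).card → DisjPair (U ∩ V) //
    (∀ i, X.IsGood s t (W i)) ∧
    (∀ i j : Fin (U ∩ V).card, (j : ℕ) = i + 1 → (W i).Consecutive (W j)) ∧
    (∀ i, X.IsPositive s t (W i))}

instance (s : (X.del U).carrier) (t : (X.del V).carrier) : Finite (X.PositiveChains s t) := by
  unfold PositiveChains
  infer_instance

end Good

/-- The wedge product `∂_U ∧ ∂_V` of face spans, a span from `X_n × X_n` to
`X_{n-|U|} × X_{n-|V|}`. -/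
def wedge {m : ℕ} (U V : Finset (Fin m)) :
    LFSpan.{u} (X.obj m × X.obj m) (X.obj (m - U.card) × X.obj (m - V.card)) where
  carrier := Σ st : (X.del U).carrier × (X.del V).carrier, X.PositiveChains st.1 st.2
  source := fun q => ((X.del U).source q.1.1, (X.del V).source q.1.2)
  target := fun q => ((X.del U).target q.1.1, (X.del V).target q.1.2)
  finite_fiber := by
    rintro ⟨x, y⟩
    have h : (⋃ st ∈ ((X.del U).source ⁻¹' {x}) ×ˢ ((X.del V).source ⁻¹' {y}),
        Set.range (fun c : X.PositiveChains st.1 st.2 =>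
          (⟨st, c⟩ : Σ st : (X.del U).carrier × (X.del V).carrier,
            X.PositiveChains st.1 st.2))).Finite :=
      (((X.del U).finite_fiber x).prod ((X.del V).finite_fiber y)).biUnion
        fun st _ => Set.finite_range _
    refine h.subset ?_
    rintro ⟨st, c⟩ hst
    have hst' : ((X.del U).source st.1, (X.del V).source st.2) = (x, y) := hst
    simp only [Set.mem_iUnion]
    exact ⟨st, ⟨congrArg Prod.fst hst', congrArg Prod.snd hst'⟩, c, rfl⟩

/-! ### The chain complex and the operations -/

/-- The set of all simplices of `X`; `⟨m, x⟩` has degree `m - 1`. -/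
abbrev Simplex : Type u := Σ m : ℕ, X.obj m

/-- The span `∇^{n,q} = ∑_U ∂_{U⁻} ∧ ∂_{U⁺}`, the sum running over the sequences `U` of length `q`
with entries in `{0, …, n}`, where `n = m - 1`; it goes from `X_n × X_n` to the union of the
`X_{n-i} × X_{n-j}` with `i + j = q`. It is empty for negative `q`. -/
def nablaSpan (m : ℕ) (q : ℤ) : LFSpan.{u} (X.obj m × X.obj m) (X.Simplex × X.Simplex) :=
  LFSpan.sum fun U : {U : TwiceSeq m // (U.length : ℤ) = q} =>
    (X.wedge U.1.minus U.1.plus).mapTarget fun y => (⟨_, y.1⟩, ⟨_, y.2⟩)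

/-- The total module `C_* = 𝔽₂⟨∐ X_n⟩` of the chain complex of `X` with coefficients in `𝔽₂`. -/
abbrev Chains : Type u := X.Simplex →₀ ZMod 2

/-- The submodule `C_n = 𝔽₂⟨X_n⟩` of chains of degree `n`. -/
def chains (n : ℤ) : Submodule (ZMod 2) X.Chains :=
  Finsupp.supported (ZMod 2) (ZMod 2) {σ : X.Simplex | (σ.1 : ℤ) - 1 = n}

/-- The differential of `C_*`: on `C_n` it is the linearisation of `∑ᵢ ∂ᵢ` (signs are
irrelevant over `𝔽₂`). -/
noncomputable def d : X.Chains →ₗ[ZMod 2] X.Chains :=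
  (LFSpan.sigma fun m => LFSpan.sum fun i : Fin m =>
    (X.del {i}).mapTarget (fun y => (⟨_, y⟩ : X.Simplex))).linearise

/-- The operation `∇_k : C_* → C_* ⊗ C_*`: the linearisation of `∑ₙ ∇^{n,n-k} ∘ Δₙ`, where `Δₙ` is
the diagonal of `X_n`. -/
noncomputable def nabla (k : ℤ) : X.Chains →ₗ[ZMod 2] X.Chains ⊗[ZMod 2] X.Chains :=
  (finsuppTensorFinsupp' (ZMod 2) X.Simplex X.Simplex).symm.toLinearMap ∘ₗ
    (LFSpan.sigma fun m =>
      (LFSpan.ofFun fun x : X.obj m => (x, x)).comp (X.nablaSpan m ((m : ℤ) - 1 - k))).linearise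

end OrderedAugSemiSimplicialBurnside

/-! ### Stable symmetric comultiplications and multiplications over `𝔽₂` -/

namespace StableSymmetric

variable {C : Type*} [AddCommGroup C] [Module (ZMod 2) C]

/-- `C = ⨁ C_n` with `d` is a chain complex. -/
structure IsChainComplex (gr : ℤ → Submodule (ZMod 2) C) (d : C →ₗ[ZMod 2] C) : Prop where
  isInternal : DirectSum.IsInternal gr
  degree : ∀ n, ∀ c ∈ gr n, d c ∈ gr (n - 1)
  d_comp_d : d ∘ₗ d = 0

/-- The degree `n` part of `C_* ⊗ C_*`. -/
def tensorGrading (gr : ℤ → Submodule (ZMod 2) C) (n : ℤ) :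
    Submodule (ZMod 2) (C ⊗[ZMod 2] C) :=
  ⨆ (p : ℤ) (q : ℤ) (_ : p + q = n),
    LinearMap.range (TensorProduct.map (gr p).subtype (gr q).subtype)

/-- The differential `d ⊗ 1 + 1 ⊗ d` of `C_* ⊗ C_*`. -/
noncomputable def tensorD (d : C →ₗ[ZMod 2] C) : C ⊗[ZMod 2] C →ₗ[ZMod 2] C ⊗[ZMod 2] C :=
  TensorProduct.map d LinearMap.id + TensorProduct.map LinearMap.id d

/-- The twist `T (a ⊗ b) = b ⊗ a`. -/
noncomputable def twist : C ⊗[ZMod 2] C →ₗ[ZMod 2] C ⊗[ZMod 2] C :=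
  (TensorProduct.comm (ZMod 2) C C).toLinearMap

/-- A stable symmetric comultiplication on the chain complex `(⨁ C_n, d)`: maps
`∇_i : C_* → C_* ⊗ C_*` of degree `i`, for `i ∈ ℤ`, with `∇_i d = d ∇_i + (1 + T) ∇_{i-1}`. -/
structure IsComultiplication (gr : ℤ → Submodule (ZMod 2) C) (d : C →ₗ[ZMod 2] C)
    (nabla : ℤ → C →ₗ[ZMod 2] C ⊗[ZMod 2] C) : Prop where
  degree : ∀ i n, ∀ c ∈ gr n, nabla i c ∈ tensorGrading gr (n + i)
  nabla_comp_d : ∀ i, nabla i ∘ₗ d =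
    tensorD d ∘ₗ nabla i + (LinearMap.id + twist) ∘ₗ nabla (i - 1)

/-- The subspaces `C^p`, with `δ`, form a cochain complex. -/
structure IsCochainComplex (gr : ℤ → Submodule (ZMod 2) C) (δ : C →ₗ[ZMod 2] C) : Prop where
  independent : iSupIndep gr
  degree : ∀ p, ∀ α ∈ gr p, δ α ∈ gr (p + 1)
  δ_comp_δ : δ ∘ₗ δ = 0

/-- A stable symmetric multiplication on a cochain complex `(C^p, δ)`: operations
`⌣_i : C^p ⊗ C^q → C^{p+q-i}`, for `i ∈ ℤ`, with
`δ(α ⌣_i β) = δα ⌣_i β + α ⌣_i δβ + α ⌣_{i-1} β + β ⌣_{i-1} α`. -/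
structure IsMultiplication (gr : ℤ → Submodule (ZMod 2) C) (δ : C →ₗ[ZMod 2] C)
    (cup : ℤ → C ⊗[ZMod 2] C →ₗ[ZMod 2] C) : Prop where
  degree : ∀ i p q, ∀ α ∈ gr p, ∀ β ∈ gr q, cup i (α ⊗ₜ β) ∈ gr (p + q - i)
  δ_cup : ∀ i p q, ∀ α ∈ gr p, ∀ β ∈ gr q,
    δ (cup i (α ⊗ₜ β)) =
      cup i (δ α ⊗ₜ β) + cup i (α ⊗ₜ δ β) + cup (i - 1) (α ⊗ₜ β) + cup (i - 1) (β ⊗ₜ α)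

/-- The cochains of degree `p`: the linear forms on `⨁ C_n` that vanish on `C_n` for `n ≠ p`
(equivalently, by restriction, the linear forms on `C_p`). -/
def cochains (gr : ℤ → Submodule (ZMod 2) C) (p : ℤ) :
    Submodule (ZMod 2) (Module.Dual (ZMod 2) C) where
  carrier := {α | ∀ n, n ≠ p → ∀ c ∈ gr n, α c = 0}
  zero_mem' := fun _ _ _ _ => rfl
  add_mem' := fun {α β} hα hβ n hn c hc => by
    rw [LinearMap.add_apply, hα n hn c hc, hβ n hn c hc, add_zero]
  smul_mem' := fun a α hα n hn c hc => by
    rw [LinearMap.smul_apply, hα n hn c hc, smul_zero]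

/-- The operation on cochains dual to `∇ : C_* → C_* ⊗ C_*`, namely
`(α ⌣ β)(c) = (α ⊗ β)(∇ c)`. -/
noncomputable def dualOperation (nabla : C →ₗ[ZMod 2] C ⊗[ZMod 2] C) :
    Module.Dual (ZMod 2) C ⊗[ZMod 2] Module.Dual (ZMod 2) C →ₗ[ZMod 2] Module.Dual (ZMod 2) C :=
  nabla.dualMap ∘ₗ TensorProduct.dualDistrib (ZMod 2) C C

end StableSymmetric

/-! Fix an n-simplex x. Through the bijections μ, each term of the identity evaluated at x becomes a
sum of target(s) ⊗ target(t) over pairs s ∈ ∂_U, t ∈ ∂_V lying over x, with |U| + |V| prescribed. It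
therefore suffices that the coefficient of each pair (s, t) vanishes modulo 2, which is
`sum_weight_eq_zero`. In ∇ this coefficient is [U, V admissible] · N^σ(∅, A), where A = U ∩ V, σ = n
+ |U| + |V|, admissible means being of the form (W⁻, W⁺), and N^σ(B, C) counts the positive maximal
flags of the face (B, C).

The flags live in a cube. The sets B ⊆ A such that s and t have the same image in ∂_B form a
down-set E. A disjoint pair (B, C) is the face [B, B ∪ C] of the cube of subsets of A, and it is
good when its bottom lies in E and its top does not. The total orders split the good faces into two
classes, exchanged when σ changes parity. `flagCount_add_flagCount` gives, with τ = σ + 1, N^σ(∅, A)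
+ N^τ(∅, A) = ∑_{a ∈ A} (N^τ(∅, A∖a) + N^τ({a}, A∖a)). It follows by induction on the dimension, as
every face of codimension two lies in exactly two facets.

Admissibility contributes two identities modulo 2. For a ∈ U ∩ V, exactly one of (U∖a, V), (U, V∖a)
is admissible if (U, V) is, and neither otherwise (`admissible_erase_add`). Deleting one element of
the symmetric difference in all possible ways gives [U, V admissible] + [V, U admissible]
(`sum_admissible_erase_symmDiff`), because a deletion reverses the parity condition on all later
entries.

The terms now match. In d∇ an element a of U or V is deleted: for a ∈ A this gives the lower facets
(∅, A∖a) with coefficient [U, V admissible], and for other a it gives N^τ(∅, A) times the second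
identity. In ∇d the pair (s, t) must agree on ∂_a, and passing to the link of a gives the upper
facets ({a}, A∖a). The terms (1 + T)∇ give N^σ(∅, A) and N^τ(∅, A), exchanging s and t being a
change of parity. The flag identity makes the total zero. The statements on cochains follow by
dualising. -/

/-! ### Counting flags of faces modulo two -/

section FlagCount

open scoped Classical in
/-- The number modulo two of flags `(B₁, C₁) ≺ … ≺ (Bᵣ, Cᵣ) = (B, C)`, `|Cᵢ| = i`, of faces of a
cube that satisfy `P` and whose bottoms satisfy `E`. -/
noncomputable def flagCount {α : Type*} [DecidableEq α] (E : Finset α → Prop)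
    (P : Finset α → Finset α → Prop) :
    ℕ → Finset α → Finset α → ZMod 2
  | 0, B, _ => if E B then 1 else 0
  | r + 1, B, C => if E B ∧ P B C then
      ∑ a ∈ C, (flagCount E P r B (C.erase a) + flagCount E P r (insert a B) (C.erase a)) else 0

variable {α : Type*} [DecidableEq α] {E E' : Finset α → Prop}
  {P Q P' : Finset α → Finset α → Prop}

open scoped Classical in
/-- The number of flags ending in a facet of the face `(B, C)`. -/
noncomputable def facetCount (E : Finset α → Prop) (P : Finset α → Finset α → Prop)
    (r : ℕ) (B C : Finset α) : ZMod 2 :=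
  ∑ a ∈ C, (flagCount E P r B (C.erase a) + flagCount E P r (insert a B) (C.erase a))

theorem flagCount_zero (B C : Finset α) [Decidable (E B)] :
    flagCount E P 0 B C = if E B then 1 else 0 := by
  unfold flagCount; congr

theorem flagCount_succ (r : ℕ) (B C : Finset α) [Decidable (E B ∧ P B C)] :
    flagCount E P (r + 1) B C = if E B ∧ P B C then facetCount E P r B C else 0 := by
  rw [flagCount]; unfold facetCount; congr

theorem flagCount_eq_zero (r : ℕ) (B C : Finset α) (h : ¬ E B) : flagCount E P r B C = 0 := by
  classical
  cases r with
  | zero => rw [flagCount_zero, if_neg h]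
  | succ r => rw [flagCount_succ, if_neg fun h' => h h'.1]

open scoped Classical in
theorem flagCount_congr {A : Finset α} (hE : ∀ B ⊆ A, (E B ↔ E' B))
    (hP : ∀ B C, B ⊆ A → C ⊆ A → Disjoint B C → (P B C ↔ P' B C)) (r : ℕ) (B C : Finset α)
    (hB : B ⊆ A) (hC : C ⊆ A) (hd : Disjoint B C) :
    flagCount E P r B C = flagCount E' P' r B C := by
  induction r generalizing B C with
  | zero => simp only [flagCount_zero, hE B hB]
  | succ r ih =>
    simp only [flagCount_succ, hE B hB, hP B C hB hC hd]
    congr 1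
    refine Finset.sum_congr rfl fun a ha => ?_
    rw [ih _ _ hB ((Finset.erase_subset _ _).trans hC)
        (hd.mono_right (Finset.erase_subset _ _)),
      ih _ _ (Finset.insert_subset (hC ha) hB) ((Finset.erase_subset _ _).trans hC)]
    rw [Finset.disjoint_insert_left]
    exact ⟨Finset.notMem_erase _ _, hd.mono_right (Finset.erase_subset _ _)⟩

open scoped Classical in
-- The cube on the smaller set is identified with an upper facet of the larger cube, where the
-- direction `i` is fixed at its upper end; facets correspond to facets. Used to pass to links.
theorem flagCount_map {β : Type*} [DecidableEq β] (e : β ↪ α) (i : α) {E' : Finset β → Prop}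
    {P' : Finset β → Finset β → Prop}
    (hE : ∀ B, E' B ↔ E (insert i (B.map e)))
    (hP : ∀ B C, E' B → (P' B C ↔ P (insert i (B.map e)) (C.map e))) (r : ℕ) (B C : Finset β) :
    flagCount E' P' r B C = flagCount E P r (insert i (B.map e)) (C.map e) := by
  induction r generalizing B C with
  | zero => simp only [flagCount_zero, hE B]
  | succ r ih =>
    have h : E' B ∧ P' B C ↔ E (insert i (B.map e)) ∧ P (insert i (B.map e)) (C.map e) := by
      rw [← hE]
      exact and_congr_right fun h => hP B C h
    simp only [flagCount_succ, h]
    congr 1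
    simp only [facetCount, Finset.sum_map]
    refine Finset.sum_congr rfl fun a ha => ?_
    rw [ih, ih, Finset.map_erase, Finset.map_insert, Finset.insert_comm]

open scoped Classical in
-- A face of codimension two lies in exactly two facets, so swapping the order in which its two
-- directions are fixed pairs off all terms: the square of the cubical boundary is zero.
theorem sum_facetCount (r : ℕ) (B C : Finset α) :
    ∑ a ∈ C, (facetCount E P r B (C.erase a) + facetCount E P r (insert a B) (C.erase a)) = 0 := by
  simp only [facetCount, ← Finset.sum_add_distrib]
  rw [Finset.sum_sigma']
  refine Finset.sum_involution (fun x _ => ⟨x.2, x.1⟩) ?_ ?_ ?_ ?_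
  · rintro ⟨a, b⟩ h
    simp only [Finset.erase_right_comm (a := b) (b := a), Finset.insert_comm b a]
    generalize flagCount E P r B _ = p
    generalize flagCount E P r (insert b B) _ = q
    generalize flagCount E P r (insert a B) _ = p'
    generalize flagCount E P r (insert a (insert b B)) _ = q'
    revert p q p' q'
    decide
  · rintro ⟨a, b⟩ h _ heq
    simp only [Finset.mem_sigma, Finset.mem_erase] at h
    exact h.2.1 (congrArg Sigma.fst heq)
  · rintro ⟨a, b⟩ h
    simp only [Finset.mem_sigma, Finset.mem_erase] at h ⊢
    exact ⟨h.2.2, Ne.symm h.2.1, h.1⟩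
  · rintro ⟨a, b⟩ h
    rfl

open scoped Classical in
/-- If `P` and `Q` partition the faces crossing from `E` to its complement, then the flags ending
in a given face that are entirely in `P` or entirely in `Q` are as many, modulo two, as the
`P`-flags of its facets. -/
theorem flagCount_add_flagCount {A : Finset α}
    (hE : ∀ B B', B ⊆ B' → B' ⊆ A → E B' → E B)
    (hPQ : ∀ B C, B ⊆ A → C ⊆ A → Disjoint B C → E B →
      (P B C ∧ ¬ Q B C ∧ ¬ E (B ∪ C)) ∨ (¬ P B C ∧ Q B C ∧ ¬ E (B ∪ C)) ∨
        (¬ P B C ∧ ¬ Q B C ∧ E (B ∪ C))) (r : ℕ) (B C : Finset α) (hr : C.card = r)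
    (hB : B ⊆ A) (hC : C ⊆ A) (hd : Disjoint B C) :
    flagCount E P r B C + flagCount E Q r B C = facetCount E P (r - 1) B C := by
  induction r generalizing B C with
  | zero =>
    -- On a vertex both counts are the indicator of `E B` and cancel. The truncated `r - 1` is
    -- harmless, since there are no facets.
    rw [Finset.card_eq_zero] at hr
    subst hr
    simp only [flagCount_zero, facetCount, Finset.sum_empty]
    split_ifs <;> decide
  | succ r ih =>
    have hi : ∀ a ∈ C, insert a B ⊆ A := fun a ha => Finset.insert_subset (hC ha) hB
    have he : ∀ a, C.erase a ⊆ A := fun a => (Finset.erase_subset _ _).trans hC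
    have hd1 : ∀ a, Disjoint B (C.erase a) := fun a => hd.mono_right (Finset.erase_subset _ _)
    have hd2 : ∀ a, Disjoint (insert a B) (C.erase a) := fun a =>
      Finset.disjoint_insert_left.2 ⟨Finset.notMem_erase _ _, hd1 a⟩
    have hc : ∀ a ∈ C, (C.erase a).card = r := fun a ha => by
      rw [Finset.card_erase_of_mem ha, hr]; rfl
    by_cases hEB : E B
    swap
    · rw [flagCount_eq_zero _ _ _ hEB, flagCount_eq_zero _ _ _ hEB, facetCount, add_zero,
        Finset.sum_eq_zero]
      intro a ha
      rw [flagCount_eq_zero _ _ _ hEB, flagCount_eq_zero, add_zero]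
      exact fun h => hEB (hE _ _ (Finset.subset_insert _ _) (hi a ha) h)
    rw [flagCount_succ, flagCount_succ, Nat.add_sub_cancel]
    rcases hPQ B C hB hC hd hEB with ⟨hP, hQ, -⟩ | ⟨hP, hQ, -⟩ | ⟨hP, hQ, hEC⟩
    · rw [if_pos ⟨hEB, hP⟩, if_neg fun h => hQ h.2, add_zero]
    · rw [if_neg fun h => hP h.2, if_pos ⟨hEB, hQ⟩, zero_add]
      -- By induction, the `P`- and `Q`-flags of the facets together form the iterated facet sum,
      -- which is zero. So the `Q`-flags of the facets are as many as the `P`-flags, modulo two.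
      have h : facetCount E P r B C + facetCount E Q r B C = 0 := by
        rw [← sum_facetCount (E := E) (P := P) (r - 1) B C]
        conv_lhs => rw [facetCount, facetCount, ← Finset.sum_add_distrib]
        refine Finset.sum_congr rfl fun a ha => ?_
        rw [add_add_add_comm, ih _ _ (hc a ha) hB (he a) (hd1 a),
          ih _ _ (hc a ha) (hi a ha) (he a) (hd2 a)]
      generalize facetCount E P r B C = p at h ⊢
      generalize facetCount E Q r B C = q at h ⊢
      revert p q
      decide
    -- The whole face lies in `E`, so no face of it crosses. Facets of positive dimension contribute
    -- nothing, and for an edge the two end vertices contribute 1 + 1.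
    · rw [if_neg fun h => hP h.2, if_neg fun h => hQ h.2, add_zero, facetCount]
      symm
      refine Finset.sum_eq_zero fun a ha => ?_
      have hBa : E (insert a B) := by
        refine hE _ (B ∪ C) ?_ (Finset.union_subset hB hC) hEC
        exact Finset.insert_subset (Finset.mem_union_right _ ha) Finset.subset_union_left
      cases r with
      | zero => rw [flagCount_zero, flagCount_zero, if_pos hEB, if_pos hBa]; decide
      | succ r =>
        have key : ∀ B', B ⊆ B' → B' ⊆ insert a B → Disjoint B' (C.erase a) →
            flagCount E P (r + 1) B' (C.erase a) = 0 := by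
          intro B' h1 h2 h3
          have h4 : B' ⊆ A := h2.trans (hi a ha)
          rw [flagCount_succ, if_neg]
          rintro ⟨h5, h6⟩
          have h7 : E (B' ∪ C.erase a) := by
            refine hE _ (B ∪ C) ?_ (Finset.union_subset hB hC) hEC
            refine Finset.union_subset (h2.trans ?_)
              ((Finset.erase_subset _ _).trans Finset.subset_union_right)
            exact Finset.insert_subset (Finset.mem_union_right _ ha) Finset.subset_union_left
          rcases hPQ B' _ h4 (he a) h3 h5 with h | h | h
          · exact h.2.2 h7
          · exact h.1 h6
          · exact h.1 h6
        rw [key _ le_rfl (Finset.subset_insert _ _) (hd1 a),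
          key _ (Finset.subset_insert _ _) le_rfl (hd2 a), add_zero]

end FlagCount

/-! ### Chains of faces -/

section Chains

open scoped Classical in
/-- The number of chains of length `r + 1` for `R` of elements satisfying `ok` that end in `F`. -/
noncomputable def chainCount {D : Type*} [Fintype D] (ok : D → Prop) (R : D → D → Prop) :
    ℕ → D → ℕ
  | 0, F => if ok F then 1 else 0
  | r + 1, F => if ok F then ∑ F' : D, if R F' F then chainCount ok R r F' else 0 else 0

/-- Removing the last member `F` leaves a chain ending in some `F'` with `R F' F`; this is the
recursion defining `chainCount`. -/
theorem card_chains {D : Type*} [Fintype D] (ok : D → Prop) (R : D → D → Prop) (r : ℕ) (F : D) :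
    Nat.card {W : Fin (r + 1) → D // (∀ i, ok (W i)) ∧
      (∀ i j : Fin (r + 1), (j : ℕ) = i + 1 → R (W i) (W j)) ∧ W (Fin.last r) = F} =
    chainCount ok R r F := by
  classical
  induction r generalizing F with
  | zero =>
    rw [chainCount]
    split_ifs with h
    · rw [Nat.card_eq_one_iff_unique]
      refine ⟨⟨?_⟩, ⟨⟨fun _ => F, fun _ => h, ?_, rfl⟩⟩⟩
      · rintro ⟨W, h1, h2, h3⟩ ⟨W', h1', h2', h3'⟩
        refine Subtype.ext (funext fun i => ?_)
        have hi : i = Fin.last 0 := Fin.ext (by simp)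
        simp only [hi, h3, h3']
      · intro i j h
        omega
    · rw [Nat.card_eq_zero]
      left
      refine ⟨?_⟩
      rintro ⟨W, h1, h2, h3⟩
      exact h (h3 ▸ h1 _)
  | succ r ih =>
    rw [chainCount]
    split_ifs with h
    swap
    · rw [Nat.card_eq_zero]
      left
      refine ⟨?_⟩
      rintro ⟨W, h1, h2, h3⟩
      exact h (h3 ▸ h1 _)
    simp only [← ih]
    let e : {W : Fin (r + 1 + 1) → D // (∀ i, ok (W i)) ∧
        (∀ i j : Fin (r + 1 + 1), (j : ℕ) = i + 1 → R (W i) (W j)) ∧ W (Fin.last (r + 1)) = F} ≃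
      Σ F' : {F' : D // R F' F}, {W : Fin (r + 1) → D // (∀ i, ok (W i)) ∧
        (∀ i j : Fin (r + 1), (j : ℕ) = i + 1 → R (W i) (W j)) ∧ W (Fin.last r) = F'.1} :=
      { toFun := fun W => ⟨⟨W.1 (Fin.last r).castSucc, by
            have := W.2.2.1 (Fin.last r).castSucc (Fin.last (r + 1)) (by simp)
            rwa [W.2.2.2] at this⟩,
          ⟨fun i => W.1 i.castSucc, fun i => W.2.1 _,
            fun i j hij => W.2.2.1 _ _ (by simpa using hij), rfl⟩⟩
        invFun := fun W => ⟨Fin.snoc (α := fun _ => D) W.2.1 F, by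
            refine fun i => Fin.lastCases ?_ (fun i => ?_) i
            · rw [Fin.snoc_last]; exact h
            · rw [Fin.snoc_castSucc]; exact W.2.2.1 i, by
            intro i j hij
            induction i using Fin.lastCases with
            | last => simp only [Fin.val_last] at hij; omega
            | cast i =>
              induction j using Fin.lastCases with
              | last =>
                have hi : i = Fin.last r := by
                  ext
                  simp only [Fin.val_last, Fin.val_castSucc] at hij ⊢
                  omega
                rw [Fin.snoc_last, Fin.snoc_castSucc, hi, W.2.2.2.2]
                exact W.1.2
              | cast j =>
                rw [Fin.snoc_castSucc, Fin.snoc_castSucc]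
                exact W.2.2.2.1 _ _ (by simpa using hij), by rw [Fin.snoc_last]⟩
        left_inv := by
          rintro ⟨W, h1, h2, h3⟩
          refine Subtype.ext (funext fun i => ?_)
          induction i using Fin.lastCases with
          | last => simp only [Fin.snoc_last, h3]
          | cast i => simp only [Fin.snoc_castSucc]
        right_inv := by
          rintro ⟨⟨F', hF'⟩, ⟨W, h1, h2, h3⟩⟩
          simp only at h3
          subst h3
          refine Sigma.subtype_ext (Subtype.ext ?_) ?_ <;> simp only [Fin.snoc_castSucc] }
    rw [Nat.card_congr e, Nat.card_sigma, ← Finset.sum_filter]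
    exact (Finset.sum_subtype (p := fun F' => R F' F) (Finset.univ.filter fun F' => R F' F)
      (by simp) fun F' => Nat.card {W : Fin (r + 1) → D // (∀ i, ok (W i)) ∧
        (∀ i j : Fin (r + 1), (j : ℕ) = i + 1 → R (W i) (W j)) ∧ W (Fin.last r) = F'}).symm

/-! ### Chains of good pairs as flags of faces of a cube. -/

namespace DisjPair

variable {m : ℕ} {A : Finset (Fin m)}

@[ext]
theorem ext' {W W' : DisjPair A} (h : W.par = W'.par) (h' : W.circ = W'.circ) : W = W' := by
  cases W; cases W'; simp only at h h'; subst h h'; rfl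

/-- The facet of a face obtained by fixing a direction at its lower end. -/
def lowerFacet (F : DisjPair A) (w : Fin m) : DisjPair A where
  par := F.par
  circ := F.circ.erase w
  disj := F.disj.mono_right (Finset.erase_subset _ _)
  par_subset := F.par_subset
  circ_subset := (Finset.erase_subset _ _).trans F.circ_subset

/-- The facet of a face obtained by fixing a direction at its upper end. -/
def upperFacet (F : DisjPair A) {w : Fin m} (hw : w ∈ F.circ) : DisjPair A where
  par := insert w F.par
  circ := F.circ.erase w
  disj := Finset.disjoint_insert_left.2 ⟨Finset.notMem_erase _ _,
    F.disj.mono_right (Finset.erase_subset _ _)⟩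
  par_subset := Finset.insert_subset (F.circ_subset hw) F.par_subset
  circ_subset := (Finset.erase_subset _ _).trans F.circ_subset

/-- The direction lost in passing from `F` to `F'` either belongs to `F'.par` or not; these are the
upper and the lower facet. -/
theorem consecutive_iff (F' F : DisjPair A) :
    F'.Consecutive F ↔ ∃ w : F.circ, F' = F.lowerFacet w ∨ F' = F.upperFacet w.2 := by
  constructor
  · rintro ⟨w, hw, h1, h2⟩
    have hwF : w ∈ F.circ := h1 ▸ Finset.mem_insert_self _ _
    have hc : F'.circ = F.circ.erase w := by rw [h1, Finset.erase_insert hw]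
    refine ⟨⟨w, hwF⟩, ?_⟩
    by_cases hwp : w ∈ F'.par
    · right
      ext1
      · simp only [upperFacet, h2, Finset.insert_erase hwp]
      · exact hc
    · left
      ext1
      · simp only [lowerFacet, h2, Finset.erase_eq_of_notMem hwp]
      · exact hc
  · rintro ⟨⟨w, hw⟩, rfl | rfl⟩
    · refine ⟨w, Finset.notMem_erase _ _, (Finset.insert_erase hw).symm, ?_⟩
      exact (Finset.erase_eq_of_notMem fun h => Finset.disjoint_left.1 F.disj h hw).symm
    · refine ⟨w, Finset.notMem_erase _ _, (Finset.insert_erase hw).symm, ?_⟩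
      exact (Finset.erase_insert fun h => Finset.disjoint_left.1 F.disj h hw).symm

open scoped Classical in
theorem sum_consecutive [Fintype (DisjPair A)] {M : Type*} [AddCommMonoid M] (F : DisjPair A)
    (φ : Finset (Fin m) → Finset (Fin m) → M) :
    (∑ F' : DisjPair A, if F'.Consecutive F then φ F'.par F'.circ else 0) =
      ∑ w ∈ F.circ, (φ F.par (F.circ.erase w) + φ (insert w F.par) (F.circ.erase w)) := by
  have h : (Finset.univ.filter fun F' : DisjPair A => F'.Consecutive F) =
      F.circ.attach.biUnion fun w => {F.lowerFacet w, F.upperFacet w.2} := by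
    ext F'
    simp [consecutive_iff]
  rw [← Finset.sum_filter, h, Finset.sum_biUnion, ← Finset.sum_attach F.circ]
  · refine Finset.sum_congr rfl fun w _ => ?_
    rw [Finset.sum_pair]
    · rfl
    · intro h
      have h1 : (w : Fin m) ∈ (F.lowerFacet w).par := by
        rw [h]; exact Finset.mem_insert_self _ _
      exact Finset.disjoint_left.1 F.disj h1 w.2
  · intro w _ w' _ hne
    rw [Function.onFun, Finset.disjoint_left]
    intro F' h1 h2
    refine hne (Subtype.ext ?_)
    have e1 : F'.circ = F.circ.erase w := by
      simp only [Finset.mem_insert, Finset.mem_singleton] at h1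
      rcases h1 with rfl | rfl <;> rfl
    have e2 : F'.circ = F.circ.erase w' := by
      simp only [Finset.mem_insert, Finset.mem_singleton] at h2
      rcases h2 with rfl | rfl <;> rfl
    by_contra hne'
    have : (w : Fin m) ∈ F.circ.erase w' := Finset.mem_erase.2 ⟨hne', w.2⟩
    rw [← e2, e1] at this
    exact Finset.notMem_erase _ _ this

variable {E : Finset (Fin m) → Prop} {P : Finset (Fin m) → Finset (Fin m) → Prop}

/-- Flags start at a vertex, chains at an edge. A crossing edge has exactly one end in `E`, its
bottom, so the additional vertex is forced. -/
theorem chainCount_eq_flagCount [Fintype (DisjPair A)] (hP : ∀ B C, P B C → ¬ E (B ∪ C)) (r : ℕ)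
    (F : DisjPair A) (hF : F.circ.card = r + 1) :
    (chainCount (fun F : DisjPair A => E F.par ∧ P F.par F.circ) Consecutive r F : ZMod 2) =
      flagCount E P (r + 1) F.par F.circ := by
  classical
  induction r generalizing F with
  | zero =>
    rw [chainCount, flagCount_succ]
    obtain ⟨a, ha⟩ := Finset.card_eq_one.1 hF
    by_cases h : E F.par ∧ P F.par F.circ
    · rw [if_pos h, if_pos h, facetCount, ha, Finset.sum_singleton, flagCount_zero,
        flagCount_zero, if_pos h.1, if_neg, Nat.cast_one, add_zero]
      have := hP _ _ h.2
      rw [ha, Finset.union_comm, ← Finset.insert_eq] at this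
      exact this
    · rw [if_neg h, if_neg h, Nat.cast_zero]
  | succ r ih =>
    rw [chainCount, flagCount_succ]
    split_ifs with h
    swap
    · rw [Nat.cast_zero]
    rw [facetCount, ← sum_consecutive (A := A) F (flagCount E P (r + 1)), Nat.cast_sum]
    refine Finset.sum_congr rfl fun F' _ => ?_
    split_ifs with h'
    · obtain ⟨w, hw, h1, h2⟩ := h'
      rw [h1, Finset.card_insert_of_notMem hw] at hF
      exact ih F' (by omega)
    · rw [Nat.cast_zero]

/-- A chain of `A.card` crossing faces has no room but to end in the whole cube `(∅, A)`. For empty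
`A` the empty chain matches the single vertex, whence `hE`. -/
theorem card_eq_flagCount (hP : ∀ B C, P B C → ¬ E (B ∪ C)) (hE : E ∅) :
    (Nat.card {W : Fin A.card → DisjPair A // (∀ i, E (W i).par ∧ P (W i).par (W i).circ) ∧
      (∀ i j : Fin A.card, (j : ℕ) = i + 1 → (W i).Consecutive (W j))} : ZMod 2) =
      flagCount E P A.card ∅ A := by
  classical
  have := Fintype.ofFinite (DisjPair A)
  generalize hr : A.card = r
  cases r with
  | zero =>
    rw [flagCount_zero, if_pos hE]
    have : Nat.card {W : Fin 0 → DisjPair A // (∀ i, E (W i).par ∧ P (W i).par (W i).circ) ∧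
        (∀ i j : Fin 0, (j : ℕ) = i + 1 → (W i).Consecutive (W j))} = 1 := by
      rw [Nat.card_eq_one_iff_unique]
      exact ⟨⟨fun a b => Subtype.ext (Subsingleton.elim _ _)⟩,
        ⟨⟨fun i => i.elim0, fun i => i.elim0, fun i => i.elim0⟩⟩⟩
    rw [this, Nat.cast_one]
  | succ r =>
    let F : DisjPair A := ⟨∅, A, Finset.disjoint_empty_left _, Finset.empty_subset _, le_rfl⟩
    have h := chainCount_eq_flagCount hP r F hr
    rw [← card_chains] at h
    refine Eq.trans ?_ h
    congr 1
    refine Nat.card_congr (Equiv.subtypeEquivRight fun W => ?_)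
    refine ⟨fun ⟨h1, h2⟩ => ⟨h1, h2, ?_⟩, fun ⟨h1, h2, _⟩ => ⟨h1, h2⟩⟩
    -- The first face has positive dimension, because a vertex cannot cross from `E` to its
    -- complement, and each step adds one dimension.
    have hcard : ∀ i : ℕ, ∀ hi : i < r + 1, i + 1 ≤ (W ⟨i, hi⟩).circ.card := by
      intro i
      induction i with
      | zero =>
        intro hi
        by_contra hlt
        have hc : (W ⟨0, hi⟩).circ = ∅ := Finset.card_eq_zero.1 (by omega)
        have h3 := h1 ⟨0, hi⟩
        rw [hc] at h3
        exact hP _ _ h3.2 (by rw [Finset.union_empty]; exact h3.1)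
      | succ i ih =>
        intro hi
        obtain ⟨w, hw, h3, -⟩ := h2 ⟨i, by omega⟩ ⟨i + 1, hi⟩ rfl
        rw [h3, Finset.card_insert_of_notMem hw]
        have := ih (by omega)
        omega
    have hlast : (W (Fin.last r)).circ = A :=
      Finset.eq_of_subset_of_card_le (W _).circ_subset (by rw [hr]; exact hcard r (by omega))
    refine DisjPair.ext' ?_ hlast
    have hd := (W (Fin.last r)).disj
    rw [hlast] at hd
    exact Finset.disjoint_self_iff_empty _ |>.1 (hd.mono_right (W (Fin.last r)).par_subset)

end DisjPair

end Chains

/-! ### Pairs of finite sets that come from sequences -/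

section Admissible

variable {m : ℕ}

/-- The index of `u` with respect to a set: the sum of `u` and its position. -/
def indexIn (S : Finset (Fin m)) (u : Fin m) : ℕ := u + (S.filter fun v => v ≤ u).card

/-- The pairs `(U⁻, U⁺)`, for `U` a sequence in which every number appears at most twice. -/
def Admissible (U V : Finset (Fin m)) : Prop :=
  ∀ u ∈ symmDiff U V, (u ∈ V ↔ Even (indexIn (U ∪ V) u))

/-! ### The bijection between sequences and admissible pairs. -/

namespace TwiceSeq

theorem index_eq (W : TwiceSeq m) (u : Fin m) : W.index u = indexIn W.reduced u := rfl

theorem fin3_cases (a : Fin 3) : a = 0 ∨ a = 1 ∨ a = 2 := by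
  revert a; decide

theorem minus_union_plus (W : TwiceSeq m) : W.minus ∪ W.plus = W.reduced := by
  ext u
  simp only [minus, plus, reduced, Finset.mem_union, Finset.mem_filter, Finset.mem_univ, true_and]
  rcases fin3_cases (W u) with h | h | h <;> simp [h]
  rcases Nat.even_or_odd (W.index u) with h | h <;> simp [h]

theorem admissible (W : TwiceSeq m) : Admissible W.minus W.plus := by
  intro u hu
  rw [minus_union_plus, ← index_eq]
  simp only [minus, plus, Finset.mem_symmDiff, Finset.mem_filter, Finset.mem_univ,
    true_and] at hu ⊢
  rcases fin3_cases (W u) with h | h | h <;> simp_all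

theorem length_eq (W : TwiceSeq m) : W.length = W.minus.card + W.plus.card := by
  simp only [length, minus, plus, Finset.card_filter, ← Finset.sum_add_distrib]
  refine Finset.sum_congr rfl fun u _ => ?_
  rcases fin3_cases (W u) with h | h | h <;> simp [h]
  rcases Nat.even_or_odd (W.index u) with h | h
  · simp [h, Nat.not_odd_iff_even.2 h]
  · simp [h, Nat.not_even_iff_odd.2 h]

/-- The sequence of the elements of two sets. -/
def ofPair (U V : Finset (Fin m)) : TwiceSeq m := fun i =>
  if i ∈ U then (if i ∈ V then 2 else 1) else if i ∈ V then 1 else 0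

theorem reduced_ofPair (U V : Finset (Fin m)) : (ofPair U V).reduced = U ∪ V := by
  ext u
  simp only [reduced, Finset.mem_filter, Finset.mem_univ, true_and, Finset.mem_union]
  by_cases h1 : u ∈ U <;> by_cases h2 : u ∈ V <;> simp [ofPair, h1, h2]

theorem minus_ofPair {U V : Finset (Fin m)} (h : Admissible U V) : (ofPair U V).minus = U := by
  ext u
  have := h u
  simp only [minus, index_eq, reduced_ofPair, Finset.mem_filter, Finset.mem_univ, true_and,
    ← Nat.not_even_iff_odd, Finset.mem_symmDiff] at this ⊢
  by_cases h1 : u ∈ U <;> by_cases h2 : u ∈ V <;> simp_all [ofPair]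

theorem plus_ofPair {U V : Finset (Fin m)} (h : Admissible U V) : (ofPair U V).plus = V := by
  ext u
  have := h u
  simp only [plus, index_eq, reduced_ofPair, Finset.mem_filter, Finset.mem_univ, true_and,
    Finset.mem_symmDiff] at this ⊢
  by_cases h1 : u ∈ U <;> by_cases h2 : u ∈ V <;> simp_all [ofPair]

theorem ofPair_minus_plus (W : TwiceSeq m) : ofPair W.minus W.plus = W := by
  funext u
  simp only [ofPair, minus, plus, Finset.mem_filter, Finset.mem_univ, true_and]
  rcases fin3_cases (W u) with h | h | h <;> simp [h]
  rcases Nat.even_or_odd (W.index u) with h | h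
  · simp [h, Nat.not_odd_iff_even.2 h]
  · simp [h, Nat.not_even_iff_odd.2 h]

open scoped Classical in
-- A sequence is recovered from (U⁻, U⁺): its repeated entries are the intersection, its single
-- entries the symmetric difference, and parity of the index decides on which side the latter lie.
theorem sum_length_eq {M : Type*} [AddCommMonoid M] (q : ℤ)
    [Fintype {W : TwiceSeq m // (W.length : ℤ) = q}]
    (F : Finset (Fin m) → Finset (Fin m) → M) :
    ∑ W : {W : TwiceSeq m // (W.length : ℤ) = q}, F W.1.minus W.1.plus =
      ∑ U : Finset (Fin m), ∑ V : Finset (Fin m),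
        if Admissible U V ∧ (U.card : ℤ) + V.card = q then F U V else 0 := by
  rw [← Fintype.sum_prod_type' (f := fun U V : Finset (Fin m) =>
    if Admissible U V ∧ (U.card : ℤ) + V.card = q then F U V else 0), ← Finset.sum_filter]
  refine Finset.sum_bij' (fun W _ => (W.1.minus, W.1.plus))
    (fun p hp => ⟨ofPair p.1 p.2, ?_⟩) ?_ ?_ ?_ ?_ ?_
  · obtain ⟨h1, h2⟩ := (Finset.mem_filter.1 hp).2
    rw [length_eq, minus_ofPair h1, plus_ofPair h1, ← h2]
    push_cast
    rfl
  · rintro ⟨W, hW⟩ _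
    refine Finset.mem_filter.2 ⟨Finset.mem_univ _, W.admissible, ?_⟩
    rw [length_eq] at hW
    exact_mod_cast hW
  · intro _ _
    exact Finset.mem_univ _
  · rintro ⟨W, hW⟩ _
    exact Subtype.ext W.ofPair_minus_plus
  · rintro ⟨U, V⟩ hp
    have h1 := (Finset.mem_filter.1 hp).2.1
    exact Prod.ext (minus_ofPair h1) (plus_ofPair h1)
  · intro _ _
    rfl

end TwiceSeq

open scoped Classical in
-- Such `a` exist only if `c` holds exactly on an initial segment. They are then its last element
-- and the first element after it: two in general, one if `c` holds everywhere or nowhere on a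
-- nonempty `D`.
theorem sum_sign_changes {α : Type*} [LinearOrder α] (D : Finset α) (c : α → Prop) :
    (∑ a ∈ D, if (∀ u ∈ D, u < a → c u) ∧ (∀ u ∈ D, a < u → ¬ c u) then (1 : ZMod 2) else 0) =
      (if ∀ u ∈ D, c u then 1 else 0) + (if ∀ u ∈ D, ¬ c u then 1 else 0) := by
  induction D using Finset.induction_on_max with
  | empty => simp; decide
  | insert M D hM ih =>
    have hMD : M ∉ D := fun h => lt_irrefl _ (hM M h)
    rw [Finset.sum_insert hMD]
    have h1 : ((∀ u ∈ insert M D, u < M → c u) ∧ ∀ u ∈ insert M D, M < u → ¬ c u) ↔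
        ∀ u ∈ D, c u := by
      constructor
      · exact fun h u hu => h.1 u (Finset.mem_insert_of_mem hu) (hM u hu)
      · intro h
        refine ⟨fun u hu hlt => ?_, fun u hu hlt => ?_⟩
        · rcases Finset.mem_insert.1 hu with rfl | hu
          · exact absurd hlt (lt_irrefl _)
          · exact h u hu
        · rcases Finset.mem_insert.1 hu with rfl | hu
          · exact absurd hlt (lt_irrefl _)
          · exact absurd hlt (hM u hu).asymm
    have h2 : ∀ a ∈ D, (((∀ u ∈ insert M D, u < a → c u) ∧ ∀ u ∈ insert M D, a < u → ¬ c u) ↔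
        ((∀ u ∈ D, u < a → c u) ∧ ∀ u ∈ D, a < u → ¬ c u) ∧ ¬ c M) := by
      intro a ha
      simp only [Finset.forall_mem_insert]
      have := hM a ha
      have := this.not_gt
      tauto
    rw [if_congr h1 rfl rfl, Finset.sum_congr rfl fun a ha => if_congr (h2 a ha) rfl rfl]
    simp only [Finset.forall_mem_insert]
    by_cases hc : c M
    · simp [hc]
    · simp only [hc, not_false_eq_true, and_true, ih, true_and, false_and, if_false]
      generalize (if ∀ u ∈ D, c u then (1 : ZMod 2) else 0) = p
      generalize (if ∀ u ∈ D, ¬ c u then (1 : ZMod 2) else 0) = q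
      revert p q
      decide

/-- Deleting `a` lowers by one the positions from `a` on, so it flips the parity of exactly the
later indices. -/
theorem indexIn_erase {S : Finset (Fin m)} {a u : Fin m} (ha : a ∈ S) :
    indexIn S u = indexIn (S.erase a) u + if a ≤ u then 1 else 0 := by
  unfold indexIn
  have h' : ((S.erase a).filter fun v => v ≤ u) = (S.filter fun v => v ≤ u).erase a :=
    Finset.filter_erase _ _ _
  rw [h']
  split_ifs with h
  · rw [add_assoc, Finset.card_erase_add_one (Finset.mem_filter.2 ⟨ha, h⟩)]
  · rw [Finset.erase_eq_of_notMem (by simp [h]), add_zero]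

theorem admissible_erase_erase {U V : Finset (Fin m)} {a : Fin m} (ha : a ∈ symmDiff U V) :
    Admissible (U.erase a) (V.erase a) ↔
      (∀ u ∈ symmDiff U V, u < a → (u ∈ V ↔ Even (indexIn (U ∪ V) u))) ∧
      (∀ u ∈ symmDiff U V, a < u → ¬ (u ∈ V ↔ Even (indexIn (U ∪ V) u))) := by
  have haU : a ∈ U ∪ V := by
    rw [Finset.mem_symmDiff] at ha
    rw [Finset.mem_union]
    tauto
  have hu : U.erase a ∪ V.erase a = (U ∪ V).erase a := (Finset.erase_union_distrib U V a).symm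
  have key : ∀ u, u ≠ a → ((u ∈ V.erase a ↔ Even (indexIn ((U ∪ V).erase a) u)) ↔
      ((u < a → (u ∈ V ↔ Even (indexIn (U ∪ V) u))) ∧
        (a < u → ¬ (u ∈ V ↔ Even (indexIn (U ∪ V) u))))) := by
    intro u hne
    rw [indexIn_erase haU, Finset.mem_erase]
    rcases lt_or_gt_of_ne hne with h | h
    · simp [h, h.not_gt, h.not_ge, hne]
    · simp only [h, h.not_gt, h.le, if_true, Nat.even_add_one, true_imp_iff, false_imp_iff, true_and,
        ne_eq, hne, not_false_eq_true]
      tauto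
  unfold Admissible
  rw [hu]
  constructor
  · intro h
    constructor <;> intro u hu hlt
    · refine ((key u hlt.ne).1 (h u ?_)).1 hlt
      simp only [Finset.mem_symmDiff, Finset.mem_erase] at hu ⊢
      have := hlt.ne
      tauto
    · refine ((key u hlt.ne').1 (h u ?_)).2 hlt
      simp only [Finset.mem_symmDiff, Finset.mem_erase] at hu ⊢
      have := hlt.ne'
      tauto
  · intro h u hu
    have hne : u ≠ a := by
      rintro rfl
      simp [Finset.mem_symmDiff] at hu
    have hu' : u ∈ symmDiff U V := by
      simp only [Finset.mem_symmDiff, Finset.mem_erase] at hu ⊢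
      tauto
    exact (key u hne).2 ⟨h.1 u hu', h.2 u hu'⟩

theorem admissible_swap {U V : Finset (Fin m)} :
    Admissible V U ↔ ∀ u ∈ symmDiff U V, ¬ (u ∈ V ↔ Even (indexIn (U ∪ V) u)) := by
  unfold Admissible
  rw [symmDiff_comm, Finset.union_comm]
  refine forall₂_congr fun u hu => ?_
  rw [Finset.mem_symmDiff] at hu
  tauto

open scoped Classical in
-- Deleting `a` keeps the parity condition before `a` and negates it after `a`, so
-- `sum_sign_changes` applies. The condition failing everywhere is admissibility of the swapped
-- pair; this is the source of `1 + T`.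
theorem sum_admissible_erase_symmDiff (U V : Finset (Fin m)) :
    ((∑ a ∈ U \ V, if Admissible (U.erase a) V then (1 : ZMod 2) else 0) +
      ∑ a ∈ V \ U, if Admissible U (V.erase a) then (1 : ZMod 2) else 0) =
      (if Admissible U V then 1 else 0) + if Admissible V U then 1 else 0 := by
  rw [if_congr (admissible_swap (U := U) (V := V)) rfl rfl]
  have h : ∑ a ∈ symmDiff U V, (if Admissible (U.erase a) (V.erase a) then (1 : ZMod 2) else 0) =
      (if Admissible U V then 1 else 0) +
        if ∀ u ∈ symmDiff U V, ¬ (u ∈ V ↔ Even (indexIn (U ∪ V) u)) then 1 else 0 := by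
    have := sum_sign_changes (symmDiff U V) fun u => (u ∈ V ↔ Even (indexIn (U ∪ V) u))
    rw [if_congr (show Admissible U V ↔
      ∀ u ∈ symmDiff U V, (u ∈ V ↔ Even (indexIn (U ∪ V) u)) from Iff.rfl) rfl rfl]
    convert this using 2 with a ha
    · by_cases hp : Admissible (U.erase a) (V.erase a)
      · rw [if_pos hp, if_pos ((admissible_erase_erase ha).1 hp)]
      · rw [if_neg hp, if_neg fun hq => hp ((admissible_erase_erase ha).2 hq)]
    · congr
    · congr
  rw [← h]
  have hs : symmDiff U V = U \ V ∪ V \ U := rfl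
  rw [hs, Finset.sum_union disjoint_sdiff_sdiff]
  congr 1
  · refine Finset.sum_congr rfl fun a ha => ?_
    rw [Finset.erase_eq_of_notMem (Finset.mem_sdiff.1 ha).2]
  · refine Finset.sum_congr rfl fun a ha => ?_
    rw [Finset.erase_eq_of_notMem (Finset.mem_sdiff.1 ha).2]

/-- The union, and hence every index, is unchanged. The only new condition is that of `a`, which is
now a single entry and must have even index to lie in `V`. -/
theorem admissible_erase_left {U V : Finset (Fin m)} {a : Fin m} (hU : a ∈ U) (hV : a ∈ V) :
    Admissible (U.erase a) V ↔ Admissible U V ∧ Even (indexIn (U ∪ V) a) := by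
  have hu : U.erase a ∪ V = U ∪ V := by
    ext u
    by_cases h : u = a <;> simp [h, hV]
  have hs : ∀ u, u ∈ symmDiff (U.erase a) V ↔ u ∈ symmDiff U V ∨ u = a := by
    intro u
    simp only [Finset.mem_symmDiff, Finset.mem_erase]
    by_cases h : u = a
    · subst h; tauto
    · tauto
  unfold Admissible
  simp only [hu, hs, or_imp, forall_and, forall_eq, hV, true_iff]

theorem admissible_erase_right {U V : Finset (Fin m)} {a : Fin m} (hU : a ∈ U) (hV : a ∈ V) :
    Admissible U (V.erase a) ↔ Admissible U V ∧ ¬ Even (indexIn (U ∪ V) a) := by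
  have hu : U ∪ V.erase a = U ∪ V := by
    ext u
    by_cases h : u = a <;> simp [h, hU]
  have hs : ∀ u, u ∈ symmDiff U (V.erase a) ↔ u ∈ symmDiff U V ∨ u = a := by
    intro u
    simp only [Finset.mem_symmDiff, Finset.mem_erase]
    by_cases h : u = a
    · subst h; tauto
    · tauto
  have hne : ∀ u ∈ symmDiff U V, u ≠ a := by
    rintro u hmem rfl
    simp [Finset.mem_symmDiff, hU, hV] at hmem
  unfold Admissible
  simp only [hu, hs, or_imp, forall_and, forall_eq, Finset.mem_erase, ne_eq, not_true_eq_false,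
    false_and, false_iff]
  refine and_congr_left fun _ => forall₂_congr fun u hu => ?_
  rw [and_iff_right (hne u hu)]

open scoped Classical in
theorem admissible_erase_add {U V : Finset (Fin m)} {a : Fin m} (hU : a ∈ U) (hV : a ∈ V) :
    (if Admissible (U.erase a) V then (1 : ZMod 2) else 0) +
      (if Admissible U (V.erase a) then 1 else 0) = if Admissible U V then 1 else 0 := by
  rw [if_congr (admissible_erase_left hU hV) rfl rfl,
    if_congr (admissible_erase_right hU hV) rfl rfl]
  by_cases h : Admissible U V <;> by_cases h' : Even (indexIn (U ∪ V) a) <;> simp [h, h']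

end Admissible

/-! ### Admissibility under a face map omitting one vertex. -/

namespace OrdFace

variable {k m : ℕ}

theorem mem_range_missing {U : Finset (Fin m)} (h : k + U.card = m) (w : Fin m) :
    (∃ i, missing U h i = w) ↔ w ∉ U := by
  have := Finset.range_orderEmbOfFin Uᶜ (k := k)
    (by rw [Finset.card_compl, Fintype.card_fin]; omega)
  rw [← Set.mem_range, missing, this]
  simp

theorem missing_notMem {U : Finset (Fin m)} (h : k + U.card = m) (i : Fin k) :
    missing U h i ∉ U := (mem_range_missing h _).1 ⟨i, rfl⟩

theorem missing_singleton_val {a : Fin m} (h : k + ({a} : Finset (Fin m)).card = m) (i : Fin k) :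
    ((missing {a} h i : Fin m) : ℕ) = i + if a ≤ missing {a} h i then 1 else 0 := by
  -- The value of `f i` is the number of elements below it: the images of those below `i`, and `a`
  -- if `a` lies below.
  set f := missing {a} h with hf
  have h1 : Finset.Iio (f i) = (Finset.Iio i).map f.toEmbedding ∪
      if a ≤ f i then {a} else ∅ := by
    ext w
    by_cases hw : w = a
    · subst hw
      have : ∀ j, f j ≠ w := fun j hj => missing_notMem h j (by simp [← hf, hj])
      have h2 : w ≠ f i := (this i).symm
      by_cases h3 : w ≤ f i
      · simp [h3, lt_of_le_of_ne h3 h2]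
      · simp [h3, this, lt_of_not_ge h3 |>.le]
    · obtain ⟨j, rfl⟩ := (mem_range_missing h w).2 (by simpa using hw)
      have h2 : f j ∉ (if a ≤ f i then {a} else ∅ : Finset (Fin m)) := by
        split_ifs
        · simpa using hw
        · simp
      rw [Finset.mem_union, ← hf]
      simp [h2]
  have h2 := congrArg Finset.card h1
  rw [Fin.card_Iio, Finset.card_union_of_disjoint, Finset.card_map, Fin.card_Iio] at h2
  · rw [h2]
    split_ifs <;> simp
  · rw [Finset.disjoint_left]
    intro w hw hw'
    obtain ⟨j, _, rfl⟩ := Finset.mem_map.1 hw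
    split_ifs at hw'
    · exact missing_notMem h j hw'
    · simp at hw'

/-- An entry past `a` is raised by one by the face map, and its position rises by one as `a` is
inserted; the parity of their sum does not change. -/
theorem indexIn_insert_map {a : Fin m} (h : k + ({a} : Finset (Fin m)).card = m)
    (S : Finset (Fin k)) (u : Fin k) :
    Even (indexIn (insert a (S.map (missing {a} h).toEmbedding)) (missing {a} h u)) ↔
      Even (indexIn S u) := by
  rw [indexIn_erase (Finset.mem_insert_self _ _), Finset.erase_insert, indexIn, indexIn,
    missing_singleton_val h u]
  · have : ((S.map (missing {a} h).toEmbedding).filter fun v => v ≤ missing {a} h u).card =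
        (S.filter fun v => v ≤ u).card := by
      rw [Finset.filter_map, Finset.card_map]
      congr 1
      ext v
      simp
    rw [this]
    split_ifs with h'
    · rw [show (u : ℕ) + 1 + (S.filter fun v => v ≤ u).card + 1 =
        (u + (S.filter fun v => v ≤ u).card) + 2 by ring, Nat.even_add]
      simp
    · simp
  · intro h'
    obtain ⟨j, _, hj⟩ := Finset.mem_map.1 h'
    exact missing_notMem h j (by simpa using hj)

theorem admissible_insert_map {a : Fin m} (h : k + ({a} : Finset (Fin m)).card = m)
    (U V : Finset (Fin k)) :
    Admissible (insert a (U.map (missing {a} h).toEmbedding))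
      (insert a (V.map (missing {a} h).toEmbedding)) ↔ Admissible U V := by
  have hne : ∀ i, missing {a} h i ≠ a := fun i hi => missing_notMem h i (by simp [hi])
  have hu : insert a (U.map (missing {a} h).toEmbedding) ∪
      insert a (V.map (missing {a} h).toEmbedding) =
      insert a ((U ∪ V).map (missing {a} h).toEmbedding) := by
    rw [Finset.map_union]
    ext w
    simp only [Finset.mem_union, Finset.mem_insert]
    tauto
  unfold Admissible
  rw [hu]
  constructor
  · intro H u hu
    have := H (missing {a} h u) (by
      simp only [Finset.mem_symmDiff, Finset.mem_insert, hne, false_or] at hu ⊢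
      simpa using hu)
    rw [indexIn_insert_map] at this
    simpa [hne] using this
  · intro H w hw
    have hwa : w ≠ a := by
      rintro rfl
      simp [Finset.mem_symmDiff] at hw
    obtain ⟨u, rfl⟩ := (mem_range_missing h w).2 (by simpa using hwa)
    rw [indexIn_insert_map]
    have := H u (by
      simp only [Finset.mem_symmDiff, Finset.mem_insert, hne, false_or] at hw ⊢
      simpa using hw)
    simpa [hne] using this

end OrdFace

/-! ### Order embeddings of finite ordinals and the sets they miss -/

namespace OrdFace

variable {j k l m : ℕ}

/-- The complement of the image of an order embedding of ordinals. -/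
def miss (f : Fin k ↪o Fin m) : Finset (Fin m) := (Finset.univ.map f.toEmbedding)ᶜ

theorem mem_miss {f : Fin k ↪o Fin m} {w : Fin m} : w ∈ miss f ↔ ∀ i, f i ≠ w := by
  simp [miss]

theorem miss_missing {U : Finset (Fin m)} (h : k + U.card = m) : miss (missing U h) = U := by
  ext w
  have := mem_range_missing h w
  rw [mem_miss, ← not_exists_not, ← not_iff_not, ← this]
  simp

theorem miss_face (U : Finset (Fin m)) : miss (face U) = U := miss_missing _

theorem add_card_miss (f : Fin k ↪o Fin m) : k + (miss f).card = m := by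
  have h := Finset.card_le_univ (Finset.univ.map f.toEmbedding)
  rw [miss, Finset.card_compl]
  simp only [Finset.card_map, Finset.card_univ, Fintype.card_fin] at h ⊢
  omega

theorem missing_miss (f : Fin k ↪o Fin m) (h : k + (miss f).card = m) : missing (miss f) h = f := by
  symm
  apply Finset.orderEmbOfFin_unique'
  intro i
  simp [miss]

/-- An order embedding is determined by the set it misses. The equality is in a sigma type because
the source ordinals, such as `m - U.card`, need not agree definitionally. -/
theorem sigma_eq_of_miss_eq {f : Fin k ↪o Fin m} {g : Fin l ↪o Fin m} (h : miss f = miss g) :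
    (⟨k, f⟩ : Σ k, Fin k ↪o Fin m) = ⟨l, g⟩ := by
  have hf := add_card_miss f
  have hg := add_card_miss g
  obtain rfl : k = l := by rw [h] at hf; omega
  have : ∀ U, ∀ h : k + U.card = m, U = miss g → missing U h = g := by
    rintro U h rfl
    exact missing_miss g h
  rw [← this _ hf h, missing_miss]

theorem trans_left_cancel {f f' : Fin k ↪o Fin l} {g : Fin l ↪o Fin m}
    (h : f.trans g = f'.trans g) : f = f' := by
  refine DFunLike.ext _ _ fun i => ?_
  simpa using DFunLike.congr_fun h i

theorem miss_subset_iff {f : Fin l ↪o Fin m} {g : Fin k ↪o Fin m} :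
    miss f ⊆ miss g ↔ ∀ i, ∃ j, f j = g i := by
  constructor
  · intro h i
    by_contra! hne
    exact mem_miss.1 (h (mem_miss.2 hne)) i rfl
  · intro h w hw
    refine mem_miss.2 fun i hi => ?_
    obtain ⟨j, hj⟩ := h i
    exact mem_miss.1 hw j (hj.trans hi)

theorem miss_trans_subset_iff {f : Fin l ↪o Fin m} {g : Fin k ↪o Fin m} (e : Fin m ↪o Fin j) :
    miss (f.trans e) ⊆ miss (g.trans e) ↔ miss f ⊆ miss g := by
  simp [miss_subset_iff]

theorem miss_trans (g : Fin k ↪o Fin l) (f : Fin l ↪o Fin m) :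
    miss (g.trans f) = miss f ∪ (miss g).map f.toEmbedding := by
  ext w
  by_cases h : ∃ i, f i = w
  · obtain ⟨i, rfl⟩ := h
    simp [mem_miss]
  · have h1 : w ∈ miss f := mem_miss.2 (by simpa using h)
    have h2 : w ∈ miss (g.trans f) := mem_miss.2 fun i hi => h ⟨g i, hi⟩
    simp [h1, h2]

theorem exists_factor {f : Fin l ↪o Fin m} {g : Fin k ↪o Fin m} (h : miss f ⊆ miss g) :
    ∃ e : Fin k ↪o Fin l, e.trans f = g := by
  choose e he using miss_subset_iff.1 h
  refine ⟨OrderEmbedding.ofMapLEIff e fun a b => ?_, ?_⟩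
  · rw [← f.le_iff_le, he, he, g.le_iff_le]
  · ext i
    simp [he]

/-- The embedding through which `g` factors over `f`. -/
noncomputable def factor {f : Fin l ↪o Fin m} {g : Fin k ↪o Fin m} (h : miss f ⊆ miss g) :
    Fin k ↪o Fin l := (exists_factor h).choose

theorem factor_trans {f : Fin l ↪o Fin m} {g : Fin k ↪o Fin m} (h : miss f ⊆ miss g) :
    (factor h).trans f = g := (exists_factor h).choose_spec

theorem miss_subset_of_trans {e : Fin k ↪o Fin l} {f : Fin l ↪o Fin m} {g : Fin k ↪o Fin m}
    (h : e.trans f = g) : miss f ⊆ miss g := by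
  rw [← h, miss_trans]
  exact Finset.subset_union_left

end OrdFace

/-! ### Projections between the face spans -/

namespace AugSemiSimplicialBurnside

open OrdFace

variable (X : AugSemiSimplicialBurnside.{u}) {i j k l m : ℕ}

/-- The first component of the fibrewise bijection for a decomposition of `g` through `f`. -/
noncomputable def proj {f : Fin l ↪o Fin m} {g : Fin k ↪o Fin m} (h : miss f ⊆ miss g)
    (s : (X.span g).carrier) : (X.span f).carrier :=
  ((X.mu f (factor h) g (factor_trans h)).toEquiv s).1.1

/-- Embeddings are monomorphisms, so the factor `e` is unique; every first component can be written
as `proj`, without reference to `e`. -/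
theorem mu_fst {f : Fin l ↪o Fin m} {g : Fin k ↪o Fin m} {e : Fin k ↪o Fin l}
    (he : e.trans f = g) (s : (X.span g).carrier) :
    ((X.mu f e g he).toEquiv s).1.1 = X.proj (miss_subset_of_trans he) s := by
  have key : ∀ (e' : Fin k ↪o Fin l) (he' : e'.trans f = g), e = e' →
      ((X.mu f e g he).toEquiv s).1.1 = ((X.mu f e' g he').toEquiv s).1.1 := by
    rintro _ _ rfl
    rfl
  exact key _ _ (trans_left_cancel (he.trans (factor_trans (miss_subset_of_trans he)).symm))

theorem source_proj {f : Fin l ↪o Fin m} {g : Fin k ↪o Fin m} (h : miss f ⊆ miss g)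
    (s : (X.span g).carrier) : (X.span f).source (X.proj h s) = (X.span g).source s :=
  (X.mu f (factor h) g (factor_trans h)).source_comp s

theorem proj_proj {f : Fin k ↪o Fin m} {f' : Fin l ↪o Fin m} {g : Fin j ↪o Fin m}
    (h : miss f' ⊆ miss f) (h' : miss f ⊆ miss g) (s : (X.span g).carrier) :
    X.proj h (X.proj h' s) = X.proj (h.trans h') s := by
  have e : ((factor h').trans (factor h)).trans f' = g :=
    (congrArg (fun e => (factor h').trans e) (factor_trans h)).trans (factor_trans h')
  have := (X.mu_assoc f' (factor h) (factor h') f ((factor h').trans (factor h)) g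
    (factor_trans h) rfl e
    (factor_trans h') s).1
  rw [X.mu_fst, X.mu_fst, X.mu_fst] at this
  exact this.symm

theorem mu_injective {f : Fin l ↪o Fin m} {g : Fin k ↪o Fin m} {e : Fin k ↪o Fin l}
    (he : e.trans f = g) {s t : (X.span g).carrier}
    (h1 : ((X.mu f e g he).toEquiv s).1.1 = ((X.mu f e g he).toEquiv t).1.1)
    (h2 : ((X.mu f e g he).toEquiv s).1.2 = ((X.mu f e g he).toEquiv t).1.2) : s = t :=
  (X.mu f e g he).toEquiv.injective (Subtype.ext (Prod.ext h1 h2))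

end AugSemiSimplicialBurnside

/-! ### Comparing two elements of face spans over the subsets of a cube. -/

namespace OrderedAugSemiSimplicialBurnside

open OrdFace

variable (X : OrderedAugSemiSimplicialBurnside.{u}) {i j k k' l m : ℕ}

section Compare

variable {f : Fin k ↪o Fin m} {g : Fin k' ↪o Fin m}

/-- The projections of `s` and `t` to the span of `b` agree. -/
def AgreeAt (s : (X.span f).carrier) (t : (X.span g).carrier) (b : Fin l ↪o Fin m) : Prop :=
  ∃ (hf : miss b ⊆ miss f) (hg : miss b ⊆ miss g), X.proj hf s = X.proj hg t

/-- The projections of `s` and `t` to the span of `b` agree, and those to the span of `c` are in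
increasing order. -/
def LessAt (s : (X.span f).carrier) (t : (X.span g).carrier) {b : Fin l ↪o Fin m}
    {c : Fin j ↪o Fin l} {d : Fin j ↪o Fin m} (e : c.trans b = d) : Prop :=
  X.AgreeAt s t b ∧ ∃ (hf : miss d ⊆ miss f) (hg : miss d ⊆ miss g),
    (X.order c).lt ((X.mu b c d e).toEquiv (X.proj hf s)).1.2
      ((X.mu b c d e).toEquiv (X.proj hg t)).1.2

/-- The projections of `s` and `t` to `∂_B` agree. -/
def Agree (s : (X.span f).carrier) (t : (X.span g).carrier) (B : Finset (Fin m)) : Prop :=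
  X.AgreeAt s t (face B)

/-- The projections of `s` and `t` to `∂_B` agree, and those to `∂_{ψ_B(C)}` are in increasing
order. -/
def Less (s : (X.span f).carrier) (t : (X.span g).carrier) (B C : Finset (Fin m)) : Prop :=
  ∃ hd : Disjoint B C, X.LessAt s t (relFace_trans hd rfl)

variable {X}
variable {s : (X.span f).carrier} {t : (X.span g).carrier}

theorem agreeAt_iff (b : Fin l ↪o Fin m) {B : Finset (Fin m)} (h : miss b = B) :
    X.AgreeAt s t b ↔ X.Agree s t B := by
  obtain ⟨rfl, h'⟩ := Sigma.mk.inj_iff.1 (sigma_eq_of_miss_eq (h.trans (miss_face B).symm))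
  obtain rfl := eq_of_heq h'
  rfl

/-- All three embeddings are determined by the sets `B` and `C`. This makes the relation for
composite embeddings, which arise in links, comparable with the one for canonical faces. -/
theorem lessAt_iff {b : Fin l ↪o Fin m} {c : Fin j ↪o Fin l} {d : Fin j ↪o Fin m}
    (e : c.trans b = d) {B C : Finset (Fin m)} (hB : miss b = B) (hC : miss d = B ∪ C)
    (hd : Disjoint B C) : X.LessAt s t e ↔ X.Less s t B C := by
  obtain ⟨rfl, h'⟩ := Sigma.mk.inj_iff.1 (sigma_eq_of_miss_eq (hB.trans (miss_face B).symm))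
  obtain rfl := eq_of_heq h'
  obtain ⟨rfl, h'⟩ := Sigma.mk.inj_iff.1 (sigma_eq_of_miss_eq (hC.trans (miss_face (B ∪ C)).symm))
  obtain rfl := eq_of_heq h'
  obtain rfl : c = relFace hd rfl := trans_left_cancel (e.trans (relFace_trans hd rfl).symm)
  exact ⟨fun h => ⟨hd, h⟩, fun h => h.2⟩

theorem agree_comm {B : Finset (Fin m)} : X.Agree s t B ↔ X.Agree t s B :=
  ⟨fun ⟨h1, h2, h3⟩ => ⟨h2, h1, h3.symm⟩, fun ⟨h1, h2, h3⟩ => ⟨h2, h1, h3.symm⟩⟩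

theorem Agree.mono {B B' : Finset (Fin m)} (h : B ⊆ B') (hB : X.Agree s t B') : X.Agree s t B := by
  obtain ⟨h1, h2, h3⟩ := hB
  have h' : miss (face B) ⊆ miss (face B') := by rwa [miss_face, miss_face]
  refine ⟨h'.trans h1, h'.trans h2, ?_⟩
  rw [← X.proj_proj h' h1, ← X.proj_proj h' h2, h3]

/-- The two orders and agreement are mutually exclusive, and one of them holds. -/
theorem less_trichotomy {B C : Finset (Fin m)} (hd : Disjoint B C)
    (hf : B ∪ C ⊆ miss f) (hg : B ∪ C ⊆ miss g) (hB : X.Agree s t B) :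
    (X.Less s t B C ∧ ¬ X.Less t s B C ∧ ¬ X.Agree s t (B ∪ C)) ∨
    (¬ X.Less s t B C ∧ X.Less t s B C ∧ ¬ X.Agree s t (B ∪ C)) ∨
    (¬ X.Less s t B C ∧ ¬ X.Less t s B C ∧ X.Agree s t (B ∪ C)) := by
  rw [← miss_face (B ∪ C)] at hf hg
  let _ := X.order (relFace hd rfl)
  set μ := (X.mu (face B) (relFace hd rfl) (face (B ∪ C)) (relFace_trans hd rfl)).toEquiv with hμ
  have h1 : X.Less s t B C ↔ (μ (X.proj hf s)).1.2 < (μ (X.proj hg t)).1.2 :=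
    ⟨fun h => h.2.2.2.2, fun h => ⟨hd, hB, hf, hg, h⟩⟩
  have h2 : X.Less t s B C ↔ (μ (X.proj hg t)).1.2 < (μ (X.proj hf s)).1.2 :=
    ⟨fun h => h.2.2.2.2, fun h => ⟨hd, agree_comm.1 hB, hg, hf, h⟩⟩
  -- Since μ is a bijection and the first components agree by `hB`, agreement at the top of the face
  -- means equality of the second components.
  have h3 : X.Agree s t (B ∪ C) ↔ (μ (X.proj hf s)).1.2 = (μ (X.proj hg t)).1.2 := by
    constructor
    · intro h
      rw [h.2.2]
    · intro h
      refine ⟨hf, hg, X.mu_injective (relFace_trans hd rfl) ?_ h⟩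
      rw [X.mu_fst, X.mu_fst, X.proj_proj, X.proj_proj]
      exact hB.2.2
  rw [h1, h2, h3]
  rcases lt_trichotomy (μ (X.proj hf s)).1.2 (μ (X.proj hg t)).1.2 with h | h | h
  · exact Or.inl ⟨h, h.asymm, h.ne⟩
  · exact Or.inr (Or.inr ⟨h.not_lt, h.not_gt, h⟩)
  · exact Or.inr (Or.inl ⟨h.asymm, h, h.ne'⟩)

theorem agreeAt_proj_left {f' : Fin i ↪o Fin m} (h : miss f' ⊆ miss f) {b : Fin l ↪o Fin m}
    (hb : miss b ⊆ miss f') : X.AgreeAt (X.proj h s) t b ↔ X.AgreeAt s t b := by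
  constructor
  · rintro ⟨h1, h2, h3⟩
    exact ⟨h1.trans h, h2, by rw [← h3, X.proj_proj]⟩
  · rintro ⟨h1, h2, h3⟩
    exact ⟨hb, h2, by rw [← h3, X.proj_proj]⟩

theorem agreeAt_comm {b : Fin l ↪o Fin m} : X.AgreeAt s t b ↔ X.AgreeAt t s b :=
  ⟨fun ⟨h1, h2, h3⟩ => ⟨h2, h1, h3.symm⟩, fun ⟨h1, h2, h3⟩ => ⟨h2, h1, h3.symm⟩⟩

theorem agree_proj_left {f' : Fin i ↪o Fin m} (h : miss f' ⊆ miss f) {B : Finset (Fin m)}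
    (hB : B ⊆ miss f') : X.Agree (X.proj h s) t B ↔ X.Agree s t B :=
  agreeAt_proj_left h (by rwa [miss_face])

theorem agree_proj_right {g' : Fin i ↪o Fin m} (h : miss g' ⊆ miss g) {B : Finset (Fin m)}
    (hB : B ⊆ miss g') : X.Agree s (X.proj h t) B ↔ X.Agree s t B := by
  rw [agree_comm, agree_proj_left h hB, agree_comm]

theorem less_proj_left {f' : Fin i ↪o Fin m} (h : miss f' ⊆ miss f) {B C : Finset (Fin m)}
    (hB : B ∪ C ⊆ miss f') : X.Less (X.proj h s) t B C ↔ X.Less s t B C := by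
  have hB' : miss (face (B ∪ C)) ⊆ miss f' := by rwa [miss_face]
  refine exists_congr fun hd => and_congr ?_ ?_
  · exact agree_proj_left h (Finset.subset_union_left.trans hB)
  · constructor
    · rintro ⟨h1, h2, h3⟩
      refine ⟨h1.trans h, h2, ?_⟩
      rwa [X.proj_proj] at h3
    · rintro ⟨h1, h2, h3⟩
      refine ⟨hB', h2, ?_⟩
      rwa [X.proj_proj]

theorem less_proj_right {g' : Fin i ↪o Fin m} (h : miss g' ⊆ miss g) {B C : Finset (Fin m)}
    (hB : B ∪ C ⊆ miss g') : X.Less s (X.proj h t) B C ↔ X.Less s t B C := by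
  have hB' : miss (face (B ∪ C)) ⊆ miss g' := by rwa [miss_face]
  refine exists_congr fun hd => and_congr ?_ ?_
  · exact agree_proj_right h (Finset.subset_union_left.trans hB)
  · constructor
    · rintro ⟨h1, h2, h3⟩
      refine ⟨h1, h2.trans h, ?_⟩
      rwa [X.proj_proj] at h3
    · rintro ⟨h1, h2, h3⟩
      refine ⟨h1, hB', ?_⟩
      rwa [X.proj_proj]

end Compare

/-! ### Passing to the link: second components over a common first component. -/

section Link

variable {X}
variable {a : Fin l ↪o Fin m} {f : Fin k ↪o Fin l} {fa : Fin k ↪o Fin m} {g : Fin k' ↪o Fin l}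
  {ga : Fin k' ↪o Fin m} (hf : f.trans a = fa) (hg : g.trans a = ga)
  {s : (X.span fa).carrier} {t : (X.span ga).carrier}

/-- This is the middle component of the associativity of μ for the decomposition through `a`, then
`b`. -/
theorem mu_proj_trans (hf : f.trans a = fa) {b : Fin j ↪o Fin l} (hb : miss b ⊆ miss f)
    (hb' : miss (b.trans a) ⊆ miss fa) (s : (X.span fa).carrier) :
    ((X.mu a b (b.trans a) rfl).toEquiv (X.proj hb' s)).1.2 =
      X.proj hb ((X.mu a f fa hf).toEquiv s).1.2 := by
  have e : (factor hb).trans (b.trans a) = fa :=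
    (congrArg (fun e => e.trans a) (factor_trans hb)).trans hf
  have h := (X.mu_assoc a b (factor hb) (b.trans a) f fa rfl (factor_trans hb) hf e s).2.1
  have h1 := X.mu_fst (factor_trans hb) ((X.mu a f fa hf).toEquiv s).1.2
  have h2 := X.mu_fst e s
  rw [h1, h2] at h
  exact h.symm

theorem agreeAt_link {b : Fin j ↪o Fin l} (ha : X.AgreeAt s t a) :
    X.AgreeAt ((X.mu a f fa hf).toEquiv s).1.2 ((X.mu a g ga hg).toEquiv t).1.2 b ↔
      X.AgreeAt s t (b.trans a) := by
  have h1 : miss (b.trans a) ⊆ miss fa ↔ miss b ⊆ miss f := by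
    rw [← hf, miss_trans_subset_iff]
  have h2 : miss (b.trans a) ⊆ miss ga ↔ miss b ⊆ miss g := by
    rw [← hg, miss_trans_subset_iff]
  obtain ⟨ha1, ha2, ha3⟩ := ha
  constructor
  · rintro ⟨h3, h4, h5⟩
    refine ⟨h1.2 h3, h2.2 h4, X.mu_injective (f := a) (e := b) rfl ?_ ?_⟩
    · rw [X.mu_fst, X.mu_fst, X.proj_proj, X.proj_proj]
      exact ha3
    · rw [mu_proj_trans hf h3, mu_proj_trans hg h4, h5]
  · rintro ⟨h3, h4, h5⟩
    refine ⟨h1.1 h3, h2.1 h4, ?_⟩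
    rw [← mu_proj_trans hf (h1.1 h3) h3, ← mu_proj_trans hg (h2.1 h4) h4, h5]

/-- By the last component of associativity, the elements compared in the link and in the original
object are the same elements of the span of `c`, so the same total order decides. -/
theorem lessAt_link {b : Fin j ↪o Fin l} {c : Fin i ↪o Fin j} {d : Fin i ↪o Fin l}
    (e : c.trans b = d) (e' : c.trans (b.trans a) = d.trans a) (ha : X.AgreeAt s t a) :
    X.LessAt ((X.mu a f fa hf).toEquiv s).1.2 ((X.mu a g ga hg).toEquiv t).1.2 e ↔
      X.LessAt s t e' := by
  have h1 : miss (d.trans a) ⊆ miss fa ↔ miss d ⊆ miss f := by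
    rw [← hf, miss_trans_subset_iff]
  have h2 : miss (d.trans a) ⊆ miss ga ↔ miss d ⊆ miss g := by
    rw [← hg, miss_trans_subset_iff]
  have key : ∀ {n : ℕ} {h : Fin n ↪o Fin l} {ha : Fin n ↪o Fin m} (hh : h.trans a = ha)
      (h3 : miss d ⊆ miss h) (h4 : miss (d.trans a) ⊆ miss ha) (s : (X.span ha).carrier),
      ((X.mu b c d e).toEquiv (X.proj h3 ((X.mu a h ha hh).toEquiv s).1.2)).1.2 =
        ((X.mu (b.trans a) c (d.trans a) e').toEquiv (X.proj h4 s)).1.2 := by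
    intro n h ha hh h3 h4 s
    rw [← mu_proj_trans hh h3 h4]
    exact (X.mu_assoc a b c (b.trans a) d (d.trans a) rfl e rfl e' _).2.2
  refine and_congr (agreeAt_link hf hg ha) ?_
  constructor
  · rintro ⟨h3, h4, h5⟩
    refine ⟨h1.2 h3, h2.2 h4, ?_⟩
    rwa [key hf h3 (h1.2 h3), key hg h4 (h2.2 h4)] at h5
  · rintro ⟨h3, h4, h5⟩
    refine ⟨h1.1 h3, h2.1 h4, ?_⟩
    rwa [key hf (h1.1 h3) h3, key hg (h2.1 h4) h4]

theorem agree_link {w : Fin m} (hw : miss a = {w}) (ha : X.AgreeAt s t a) (B : Finset (Fin l)) :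
    X.Agree ((X.mu a f fa hf).toEquiv s).1.2 ((X.mu a g ga hg).toEquiv t).1.2 B ↔
      X.Agree s t (insert w (B.map a.toEmbedding)) := by
  rw [Agree, agreeAt_link hf hg ha, agreeAt_iff]
  rw [miss_trans, hw, miss_face]
  rfl

theorem less_link {w : Fin m} (hw : miss a = {w}) (ha : X.AgreeAt s t a) (B C : Finset (Fin l)) :
    X.Less ((X.mu a f fa hf).toEquiv s).1.2 ((X.mu a g ga hg).toEquiv t).1.2 B C ↔
      X.Less s t (insert w (B.map a.toEmbedding)) (C.map a.toEmbedding) := by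
  have hwa : ∀ i, a i ≠ w := mem_miss.1 (by rw [hw]; exact Finset.mem_singleton_self _)
  have hdd : Disjoint (insert w (B.map a.toEmbedding)) (C.map a.toEmbedding) ↔ Disjoint B C := by
    rw [Finset.disjoint_insert_left, Finset.disjoint_map, and_iff_right]
    simp [hwa]
  by_cases hd : Disjoint B C
  · rw [← lessAt_iff (relFace_trans hd rfl) (miss_face B) (miss_face _) hd,
      lessAt_link hf hg (relFace_trans hd rfl)
        (by rw [← relFace_trans hd rfl]; rfl) ha]
    refine lessAt_iff _ ?_ ?_ (hdd.2 hd)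
    · rw [miss_trans, hw, miss_face]
      rfl
    · rw [miss_trans, hw, miss_face, Finset.map_union, Finset.insert_union]
      rfl
  · exact ⟨fun h => absurd h.1 hd, fun h => absurd (hdd.1 h.1) hd⟩

end Link

end OrderedAugSemiSimplicialBurnside

/-! ### The coefficients of the operations -/

namespace OrderedAugSemiSimplicialBurnside

open OrdFace

variable {X : OrderedAugSemiSimplicialBurnside.{u}} {i j k k' l m : ℕ}

section Count

variable {f : Fin k ↪o Fin m} {g : Fin k' ↪o Fin m}

/-- The order on the projections of `s` and `t`, reversed when `σ` is odd. -/
def Pos (σ : ℤ) (s : (X.span f).carrier) (t : (X.span g).carrier) (B C : Finset (Fin m)) : Prop :=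
  (Even σ ∧ X.Less s t B C) ∨ (Odd σ ∧ X.Less t s B C)

/-- The number modulo two of positive maximal flags in the face `(B, C)`. -/
noncomputable def count (σ : ℤ) (s : (X.span f).carrier) (t : (X.span g).carrier)
    (B C : Finset (Fin m)) : ZMod 2 :=
  flagCount (X.Agree s t) (Pos σ s t) C.card B C

variable {s : (X.span f).carrier} {t : (X.span g).carrier}

theorem pos_of_even {σ : ℤ} (h : Even σ) : Pos σ s t = X.Less s t := by
  funext B C
  simp [Pos, h, Int.not_odd_iff_even.2 h]

theorem pos_of_odd {σ : ℤ} (h : Odd σ) : Pos σ s t = X.Less t s := by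
  funext B C
  simp [Pos, h, Int.not_even_iff_odd.2 h]

theorem count_congr {σ τ : ℤ} (h : Even σ ↔ Even τ) (B C : Finset (Fin m)) :
    count σ s t B C = count τ s t B C := by
  unfold count Pos
  simp only [← Int.not_even_iff_odd, h]

theorem count_swap {σ τ : ℤ} (h : Even σ ↔ ¬ Even τ) (B C : Finset (Fin m)) :
    count σ s t B C = count τ t s B C := by
  have h1 : X.Agree s t = X.Agree t s := funext fun B => propext agree_comm
  have h2 : Pos σ s t = Pos τ t s := by
    funext B C
    simp only [Pos, ← Int.not_even_iff_odd, h, not_not]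
    exact propext or_comm
  rw [count, count, h1, h2]

theorem count_eq_zero {σ : ℤ} {B C : Finset (Fin m)} (h : ¬ X.Agree s t B) :
    count σ s t B C = 0 := flagCount_eq_zero _ _ _ h

theorem pos_trichotomy (σ : ℤ) {B C : Finset (Fin m)} (hd : Disjoint B C)
    (hf : B ∪ C ⊆ miss f) (hg : B ∪ C ⊆ miss g) (hB : X.Agree s t B) :
    (Pos σ s t B C ∧ ¬ Pos (σ + 1) s t B C ∧ ¬ X.Agree s t (B ∪ C)) ∨
    (¬ Pos σ s t B C ∧ Pos (σ + 1) s t B C ∧ ¬ X.Agree s t (B ∪ C)) ∨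
    (¬ Pos σ s t B C ∧ ¬ Pos (σ + 1) s t B C ∧ X.Agree s t (B ∪ C)) := by
  have := less_trichotomy hd hf hg hB
  rcases Int.even_or_odd σ with h | h
  · rw [pos_of_even h, pos_of_odd h.add_one]
    exact this
  · rw [pos_of_odd h, pos_of_even h.add_one]
    tauto

/-- `flagCount_add_flagCount` for the down-set of agreement, with the class for `σ + 1` as `P`,
since that parity occurs in the boundary terms. -/
theorem count_add_count (σ : ℤ) {A : Finset (Fin m)} (hf : A ⊆ miss f) (hg : A ⊆ miss g) :
    count σ s t ∅ A + count (σ + 1) s t ∅ A =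
      ∑ a ∈ A, (count (σ + 1) s t ∅ (A.erase a) + count (σ + 1) s t {a} (A.erase a)) := by
  rw [add_comm]
  refine (flagCount_add_flagCount (E := X.Agree s t) (A := A) ?_ ?_ A.card ∅ A rfl
    (Finset.empty_subset _) le_rfl (Finset.disjoint_empty_left _)).trans ?_
  · exact fun B B' h _ h' => Agree.mono h h'
  · intro B C hB hC hd hE
    have h := Finset.union_subset hB hC
    have := pos_trichotomy σ hd (h.trans hf) (h.trans hg) hE
    tauto
  · refine Finset.sum_congr rfl fun a ha => ?_
    rw [count, count, Finset.card_erase_of_mem ha]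
    rfl

/-- The flags only involve projections to ∂_B with B ⊆ A, and these factor through `f'`. -/
theorem count_proj_left (σ : ℤ) {f' : Fin i ↪o Fin m} (h : miss f' ⊆ miss f)
    {A : Finset (Fin m)} (hA : A ⊆ miss f') :
    count σ (X.proj h s) t ∅ A = count σ s t ∅ A := by
  refine flagCount_congr (A := A) ?_ ?_ _ _ _ (Finset.empty_subset _) le_rfl
    (Finset.disjoint_empty_left _)
  · exact fun B hB => agree_proj_left h (hB.trans hA)
  · intro B C hB hC _
    have h' := (Finset.union_subset hB hC).trans hA
    exact or_congr (and_congr_right fun _ => less_proj_left h h')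
      (and_congr_right fun _ => less_proj_right h h')

theorem count_proj_right (σ : ℤ) {g' : Fin i ↪o Fin m} (h : miss g' ⊆ miss g)
    {A : Finset (Fin m)} (hA : A ⊆ miss g') :
    count σ s (X.proj h t) ∅ A = count σ s t ∅ A := by
  have h1 : Even (σ + 1) ↔ ¬ Even σ := Int.even_add_one
  rw [← count_swap h1, count_proj_left _ h hA, count_swap h1]

end Count

theorem count_link (σ : ℤ) {a : Fin l ↪o Fin m} {f : Fin k ↪o Fin l} {fa : Fin k ↪o Fin m}
    {g : Fin k' ↪o Fin l} {ga : Fin k' ↪o Fin m} (hf : f.trans a = fa) (hg : g.trans a = ga)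
    {s : (X.span fa).carrier} {t : (X.span ga).carrier} {w : Fin m} (hw : miss a = {w})
    (ha : X.AgreeAt s t a) (C : Finset (Fin l)) :
    count σ ((X.mu a f fa hf).toEquiv s).1.2 ((X.mu a g ga hg).toEquiv t).1.2 ∅ C =
      count σ s t {w} (C.map a.toEmbedding) := by
  refine (flagCount_map (E := X.Agree s t) (P := Pos σ s t) a.toEmbedding w
    (agree_link hf hg hw ha) ?_ _ _ _).trans ?_
  · intro B C _
    exact or_congr (and_congr_right fun _ => less_link hf hg hw ha _ _)
      (and_congr_right fun _ => less_link hg hf hw (agreeAt_comm.1 ha) _ _)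
  · rw [count, Finset.card_map]
    rfl

/-- The span of the identity is the identity span, so the projection to ∂_∅ records just the source.
-/
theorem agree_empty {f : Fin k ↪o Fin m} {g : Fin k' ↪o Fin m} {s : (X.span f).carrier}
    {t : (X.span g).carrier} (h : (X.span f).source s = (X.span g).source t) :
    X.Agree s t ∅ := by
  have h0 : miss (RelEmbedding.refl (· ≤ ·) : Fin m ↪o Fin m) = ∅ := by
    ext w
    simp [mem_miss]
  rw [← agreeAt_iff (RelEmbedding.refl (· ≤ ·) : Fin m ↪o Fin m) h0]
  have hi : Function.Injective
      (X.span (RelEmbedding.refl (· ≤ ·) : Fin m ↪o Fin m)).source := by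
    rw [X.span_id]
    exact fun _ _ h => h
  refine ⟨by rw [h0]; exact Finset.empty_subset _, by rw [h0]; exact Finset.empty_subset _,
    hi ?_⟩
  rw [X.source_proj, X.source_proj, h]

/-- A strict inequality already implies that the two images differ, so of goodness only agreement at
the bottom remains. -/
theorem isGood_and_isPositive_iff {U V : Finset (Fin m)} (s : (X.del U).carrier)
    (t : (X.del V).carrier) (W : DisjPair (U ∩ V)) :
    X.IsGood s t W ∧ X.IsPositive s t W ↔
      X.Agree s t W.par ∧ Pos ((m : ℤ) - 1 + U.card + V.card) s t W.par W.circ := by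
  have hf : W.par ∪ W.circ ⊆ miss (face U) := by
    rw [miss_face]
    exact (Finset.union_subset W.par_subset W.circ_subset).trans Finset.inter_subset_left
  have hg : W.par ∪ W.circ ⊆ miss (face V) := by
    rw [miss_face]
    exact (Finset.union_subset W.par_subset W.circ_subset).trans Finset.inter_subset_right
  rw [← miss_face (W.par ∪ W.circ)] at hf hg
  have hp : miss (face W.par) ⊆ miss (face (W.par ∪ W.circ)) := by
    rw [miss_face, miss_face]
    exact Finset.subset_union_left
  have hE : X.Agree s t W.par ↔ X.parLeft W s = X.parRight W t := by
    unfold parLeft parRight AugSemiSimplicialBurnside.lam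
    rw [X.mu_fst, X.mu_fst]
    exact ⟨fun h => h.2.2, fun h => ⟨hp.trans hf, hp.trans hg, h⟩⟩
  have hs : X.circLeft W s = ((X.mu (face W.par) (relFace W.disj rfl) (face (W.par ∪ W.circ))
      (relFace_trans _ _)).toEquiv (X.proj hf s)).1.2 := by
    unfold circLeft AugSemiSimplicialBurnside.lam₂ AugSemiSimplicialBurnside.lam
    rw [X.mu_fst]
  have ht : X.circRight W t = ((X.mu (face W.par) (relFace W.disj rfl) (face (W.par ∪ W.circ))
      (relFace_trans _ _)).toEquiv (X.proj hg t)).1.2 := by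
    unfold circRight AugSemiSimplicialBurnside.lam₂ AugSemiSimplicialBurnside.lam
    rw [X.mu_fst]
  have hlt : X.Agree s t W.par → (X.Less s t W.par W.circ ↔
      (X.order (relFace W.disj rfl)).lt (X.circLeft W s) (X.circRight W t)) := by
    intro h
    rw [hs, ht]
    exact ⟨fun h => h.2.2.2.2, fun h' => ⟨W.disj, h, hf, hg, h'⟩⟩
  have hgt : X.Agree s t W.par → (X.Less t s W.par W.circ ↔
      (X.order (relFace W.disj rfl)).lt (X.circRight W t) (X.circLeft W s)) := by
    intro h
    rw [hs, ht]
    exact ⟨fun h => h.2.2.2.2, fun h' => ⟨W.disj, agree_comm.1 h, hg, hf, h'⟩⟩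
  rw [IsGood, and_assoc, ← hE]
  refine and_congr_right fun h => ?_
  rw [IsPositive, ← hlt h, ← hgt h]
  refine and_iff_right_of_imp ?_
  let _ := X.order (relFace W.disj rfl)
  rintro (⟨-, h'⟩ | ⟨-, h'⟩)
  · exact ne_of_lt ((hlt h).1 h')
  · exact ne_of_gt ((hgt h).1 h')

theorem card_positiveChains {U V : Finset (Fin m)} (s : (X.del U).carrier)
    (t : (X.del V).carrier) (hst : (X.del U).source s = (X.del V).source t) :
    (Nat.card (X.PositiveChains s t) : ZMod 2) =
      count ((m : ℤ) - 1 + U.card + V.card) s t ∅ (U ∩ V) := by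
  let σ : ℤ := (m : ℤ) - 1 + U.card + V.card
  -- `DisjPair.card_eq_flagCount` asks that the top lie outside the down-set for all `B`, `C`;
  -- adding this as a condition changes nothing on the faces of the cube.
  let P : Finset (Fin m) → Finset (Fin m) → Prop := fun B C =>
    Pos σ s t B C ∧ ¬ X.Agree s t (B ∪ C)
  have hW : ∀ W : DisjPair (U ∩ V), X.IsGood s t W ∧ X.IsPositive s t W ↔
      X.Agree s t W.par ∧ P W.par W.circ := by
    intro W
    rw [isGood_and_isPositive_iff]
    refine and_congr_right fun h => (and_iff_left_of_imp fun hP => ?_).symm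
    have hsub := Finset.union_subset W.par_subset W.circ_subset
    have := pos_trichotomy σ W.disj
      (by rw [miss_face]; exact hsub.trans Finset.inter_subset_left)
      (by rw [miss_face]; exact hsub.trans Finset.inter_subset_right) h
    tauto
  have h1 : count σ s t ∅ (U ∩ V) = flagCount (X.Agree s t) P (U ∩ V).card ∅ (U ∩ V) := by
    refine flagCount_congr (A := U ∩ V) (fun _ _ => Iff.rfl) ?_ _ _ _ (Finset.empty_subset _)
      le_rfl (Finset.disjoint_empty_left _)
    intro B C hB hC hd
    refine (and_iff_left_of_imp fun hP => ?_).symm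
    have h : X.Agree s t B := by
      rcases hP with ⟨-, h⟩ | ⟨-, h⟩
      · exact h.2.1
      · exact agree_comm.1 h.2.1
    have hsub := Finset.union_subset hB hC
    have := pos_trichotomy σ hd
      (by rw [miss_face]; exact hsub.trans Finset.inter_subset_left)
      (by rw [miss_face]; exact hsub.trans Finset.inter_subset_right) h
    tauto
  rw [h1, ← DisjPair.card_eq_flagCount (fun B C h => h.2) (agree_empty hst)]
  congr 1
  refine Nat.card_congr (Equiv.subtypeEquivRight fun W => ?_)
  simp only [← hW, forall_and]
  tauto

open scoped Classical in
/-- The coefficient of `(s, t)` in the operations. -/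
noncomputable def weight {f : Fin k ↪o Fin m} {g : Fin k' ↪o Fin m} (s : (X.span f).carrier)
    (t : (X.span g).carrier) : ZMod 2 :=
  if Admissible (miss f) (miss g) then
    count ((m : ℤ) - 1 + (miss f).card + (miss g).card) s t ∅ (miss f ∩ miss g) else 0

open scoped Classical in
/-- The coefficient in the operations of the pair of second components of `s` and `t` with respect
to `a`, provided that the first components agree. -/
noncomputable def linkWeight {f : Fin k ↪o Fin m} {g : Fin k' ↪o Fin m} (s : (X.span f).carrier)
    (t : (X.span g).carrier) (a : Fin l ↪o Fin m) : ZMod 2 :=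
  if h : X.AgreeAt s t a then
    weight ((X.mu a (factor h.1) f (factor_trans _)).toEquiv s).1.2
      ((X.mu a (factor h.2.1) g (factor_trans _)).toEquiv t).1.2 else 0

theorem erase_face_subset (U : Finset (Fin m)) (a : Fin m) :
    miss (face (U.erase a)) ⊆ miss (face U) := by
  rw [miss_face, miss_face]
  exact Finset.erase_subset _ _

section Weight

variable {U V : Finset (Fin m)} (s : (X.del U).carrier) (t : (X.del V).carrier)

open scoped Classical in
theorem weight_face : weight s t = if Admissible U V then
    count ((m : ℤ) - 1 + U.card + V.card) s t ∅ (U ∩ V) else 0 := by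
  rw [weight]
  simp only [miss_face]

open scoped Classical in
-- The flags are unaffected by projecting `s`, but |U| drops by one, so the sign of positivity
-- changes.
theorem weight_proj_left {a : Fin m} (ha : a ∈ U) :
    weight (X.proj (erase_face_subset U a) s) t = if Admissible (U.erase a) V then
      count ((m : ℤ) - 1 + U.card + V.card + 1) s t ∅ (U.erase a ∩ V) else 0 := by
  rw [weight_face, count_proj_left _ _ (by rw [miss_face]; exact Finset.inter_subset_left),
    Finset.card_erase_of_mem ha]
  congr 1
  apply count_congr
  have := Finset.card_pos.2 ⟨a, ha⟩
  rw [Nat.cast_sub (by omega)]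
  grind

open scoped Classical in
theorem weight_proj_right {a : Fin m} (ha : a ∈ V) :
    weight s (X.proj (erase_face_subset V a) t) = if Admissible U (V.erase a) then
      count ((m : ℤ) - 1 + U.card + V.card + 1) s t ∅ (U ∩ V.erase a) else 0 := by
  rw [weight_face, count_proj_right _ _ (by rw [miss_face]; exact Finset.inter_subset_right),
    Finset.card_erase_of_mem ha]
  congr 1
  apply count_congr
  have := Finset.card_pos.2 ⟨a, ha⟩
  rw [Nat.cast_sub (by omega)]
  grind

open scoped Classical in
theorem weight_swap : weight t s = if Admissible V U then
    count ((m : ℤ) - 1 + U.card + V.card + 1) s t ∅ (U ∩ V) else 0 := by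
  rw [weight_face, Finset.inter_comm]
  congr 1
  apply count_swap
  grind

open scoped Classical in
-- Flags in the link of `a` are flags in the upper facet at `a`, and admissibility is preserved by
-- `admissible_insert_map`.
theorem linkWeight_face (a : Fin m) :
    linkWeight s t (face {a}) = if Admissible U V then
      count ((m : ℤ) - 1 + U.card + V.card + 1) s t {a} ((U ∩ V).erase a) else 0 := by
  by_cases h : X.AgreeAt s t (face {a})
  swap
  · rw [linkWeight, dif_neg h, count_eq_zero h, ite_self]
  rw [linkWeight, dif_pos h, weight]
  have hne : ∀ i, face {a} i ≠ a :=
    mem_miss.1 (by rw [miss_face]; exact Finset.mem_singleton_self _)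
  have hU' : insert a ((miss (factor h.1)).map (face {a}).toEmbedding) = U := by
    have := miss_trans (factor h.1) (face {a})
    rw [factor_trans, miss_face, miss_face] at this
    exact this.symm
  have hV' : insert a ((miss (factor h.2.1)).map (face {a}).toEmbedding) = V := by
    have := miss_trans (factor h.2.1) (face {a})
    rw [factor_trans, miss_face, miss_face] at this
    exact this.symm
  have hadm : Admissible (miss (factor h.1)) (miss (factor h.2.1)) ↔ Admissible U V := by
    rw [← admissible_insert_map (sub_add_card {a})]
    rw [← face, hU', hV']
  have hI : (U ∩ V).erase a =
      (miss (factor h.1) ∩ miss (factor h.2.1)).map (face {a}).toEmbedding := by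
    have key : ∀ U' V' : Finset (Fin (m - ({a} : Finset (Fin m)).card)),
        insert a (U'.map (face {a}).toEmbedding) = U →
        insert a (V'.map (face {a}).toEmbedding) = V →
        (U ∩ V).erase a = (U' ∩ V').map (face {a}).toEmbedding := by
      intro U' V' h1 h2
      rw [← h1, ← h2, Finset.map_inter, ← Finset.insert_inter_distrib, Finset.erase_insert]
      simp [hne]
    exact key _ _ hU' hV'
  have hcU : U.card = (miss (factor h.1)).card + 1 := by
    conv_lhs => rw [← hU']
    rw [Finset.card_insert_of_notMem (by simp [hne]), Finset.card_map]
  have hcV : V.card = (miss (factor h.2.1)).card + 1 := by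
    conv_lhs => rw [← hV']
    rw [Finset.card_insert_of_notMem (by simp [hne]), Finset.card_map]
  rw [if_congr hadm rfl rfl, hI, count_link _ _ _ (miss_face _) h]
  congr 1
  -- In the link n, |U| and |V| each drop by one; the total shift is three, with the same parity as
  -- `+ 1`.
  apply count_congr
  have hm : 1 ≤ m := a.pos
  generalize (miss (factor h.1)).card = p at hcU ⊢
  generalize (miss (factor h.2.1)).card = q at hcV ⊢
  rw [hcU, hcV, Finset.card_singleton, Nat.cast_sub hm]
  push_cast
  grind

theorem linkWeight_face_eq_zero {a : Fin m} (h : ¬ (a ∈ U ∧ a ∈ V)) :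
    linkWeight s t (face {a}) = 0 := by
  rw [linkWeight, dif_neg]
  rintro ⟨h1, h2, -⟩
  rw [miss_face, miss_face, Finset.singleton_subset_iff] at h1 h2
  exact h ⟨h1, h2⟩

/-- The coefficient of `(s, t)` in `∇ d + d ∇ + (1 + T) ∇` is zero. -/
theorem sum_weight_eq_zero :
    ∑ a ∈ U, weight (X.proj (erase_face_subset U a) s) t +
      ∑ a ∈ V, weight s (X.proj (erase_face_subset V a) t) +
      (weight s t + weight t s) + ∑ a : Fin m, linkWeight s t (face {a}) = 0 := by
  classical
  set τ := (m : ℤ) - 1 + U.card + V.card + 1 with hτ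
  have h1 : ∑ a : Fin m, linkWeight s t (face {a}) =
      (if Admissible U V then 1 else 0) * ∑ a ∈ U ∩ V, count τ s t {a} ((U ∩ V).erase a) := by
    rw [Finset.mul_sum, ← Finset.sum_subset (Finset.subset_univ (U ∩ V))]
    · refine Finset.sum_congr rfl fun a ha => ?_
      rw [Finset.mem_inter] at ha
      rw [linkWeight_face s t a, ite_mul, one_mul, zero_mul]
    · intro a _ ha
      rw [Finset.mem_inter] at ha
      exact linkWeight_face_eq_zero s t ha
  have h2 : ∑ a ∈ U, weight (X.proj (erase_face_subset U a) s) t =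
      ∑ a ∈ U ∩ V, (if Admissible (U.erase a) V then 1 else 0) *
          count τ s t ∅ ((U ∩ V).erase a) +
        (∑ a ∈ U \ V, if Admissible (U.erase a) V then 1 else 0) * count τ s t ∅ (U ∩ V) := by
    rw [← Finset.sum_inter_add_sum_sdiff U V, Finset.sum_mul]
    congr 1
    · refine Finset.sum_congr rfl fun a ha => ?_
      rw [weight_proj_left s t (Finset.mem_inter.1 ha).1, ite_mul, one_mul, zero_mul,
        Finset.erase_inter]
    · refine Finset.sum_congr rfl fun a ha => ?_
      rw [weight_proj_left s t (Finset.mem_sdiff.1 ha).1, ite_mul, one_mul, zero_mul,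
        Finset.erase_inter, Finset.erase_eq_of_notMem (s := U ∩ V)]
      exact fun h => (Finset.mem_sdiff.1 ha).2 (Finset.mem_inter.1 h).2
  have h3 : ∑ a ∈ V, weight s (X.proj (erase_face_subset V a) t) =
      ∑ a ∈ U ∩ V, (if Admissible U (V.erase a) then 1 else 0) *
          count τ s t ∅ ((U ∩ V).erase a) +
        (∑ a ∈ V \ U, if Admissible U (V.erase a) then 1 else 0) * count τ s t ∅ (U ∩ V) := by
    rw [← Finset.sum_inter_add_sum_sdiff V U, Finset.sum_mul, Finset.inter_comm V U]
    congr 1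
    · refine Finset.sum_congr rfl fun a ha => ?_
      rw [weight_proj_right s t (Finset.mem_inter.1 ha).2, ite_mul, one_mul, zero_mul,
        Finset.inter_erase]
    · refine Finset.sum_congr rfl fun a ha => ?_
      rw [weight_proj_right s t (Finset.mem_sdiff.1 ha).1, ite_mul, one_mul, zero_mul,
        Finset.inter_erase, Finset.erase_eq_of_notMem (s := U ∩ V)]
      exact fun h => (Finset.mem_sdiff.1 ha).2 (Finset.mem_inter.1 h).1
  have h4 : ∑ a ∈ U ∩ V, (if Admissible (U.erase a) V then 1 else 0) *
        count τ s t ∅ ((U ∩ V).erase a) + ∑ a ∈ U ∩ V,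
        (if Admissible U (V.erase a) then 1 else 0) * count τ s t ∅ ((U ∩ V).erase a) =
      (if Admissible U V then 1 else 0) * ∑ a ∈ U ∩ V, count τ s t ∅ ((U ∩ V).erase a) := by
    rw [← Finset.sum_add_distrib, Finset.mul_sum]
    refine Finset.sum_congr rfl fun a ha => ?_
    rw [← add_mul, admissible_erase_add (Finset.mem_inter.1 ha).1 (Finset.mem_inter.1 ha).2]
  have h5 := sum_admissible_erase_symmDiff U V
  have h6 := count_add_count (s := s) (t := t) ((m : ℤ) - 1 + U.card + V.card) (A := U ∩ V)
    (by rw [miss_face]; exact Finset.inter_subset_left)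
    (by rw [miss_face]; exact Finset.inter_subset_right)
  rw [← hτ, Finset.sum_add_distrib] at h6
  have h7 : weight s t = (if Admissible U V then 1 else 0) *
      count ((m : ℤ) - 1 + U.card + V.card) s t ∅ (U ∩ V) := by
    rw [weight_face, ite_mul, one_mul, zero_mul]
  have h8 : weight t s = (if Admissible V U then 1 else 0) * count τ s t ∅ (U ∩ V) := by
    rw [weight_swap, ite_mul, one_mul, zero_mul]
  rw [h1, h2, h3, h7, h8]
  have h2' : (2 : ZMod 2) = 0 := rfl
  -- Lower facets from `h4` and upper facets from ∇d combine through `h6`; the remaining terms occur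
  -- twice and vanish by `h2'`.
  linear_combination h4 + count τ s t ∅ (U ∩ V) * h5 -
    (if Admissible U V then 1 else 0) * h6 +
    ((if Admissible U V then 1 else 0) * (count ((m : ℤ) - 1 + U.card + V.card) s t ∅ (U ∩ V) +
      count τ s t ∅ (U ∩ V)) + (if Admissible V U then 1 else 0) * count τ s t ∅ (U ∩ V)) * h2'
end Weight

end OrderedAugSemiSimplicialBurnside

/-! ### Sums over the fibres of spans -/

namespace LFSpan

variable {X Y Z : Type u} {M : Type*} [AddCommMonoid M]

/-- The fibre of the source map as a finite set. -/
noncomputable def fib (S : LFSpan.{u} X Y) (x : X) : Finset S.carrier := (S.finite_fiber x).toFinset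

theorem mem_fib {S : LFSpan.{u} X Y} {x : X} {q : S.carrier} : q ∈ S.fib x ↔ S.source q = x := by
  simp [fib]

theorem linearise_single (S : LFSpan.{u} X Y) (x : X) :
    S.linearise (Finsupp.single x 1) = ∑ q ∈ S.fib x, Finsupp.single (S.target q) 1 := by
  rw [linearise, Finsupp.linearCombination_single, one_smul]
  rfl

theorem sum_fib_comp (S : LFSpan.{u} X Y) (S' : LFSpan.{u} Y Z) (x : X)
    (F : S.carrier → S'.carrier → M) :
    ∑ q ∈ (S.comp S').fib x, F q.1.1 q.1.2 =
      ∑ a ∈ S.fib x, ∑ b ∈ S'.fib (S.target a), F a b := by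
  rw [Finset.sum_sigma']
  refine Finset.sum_bij' (fun q _ => ⟨q.1.1, q.1.2⟩)
    (fun p hp => ⟨(p.1, p.2), (mem_fib.1 (Finset.mem_sigma.1 hp).2).symm⟩) ?_ ?_ ?_ ?_ ?_
  · intro q hq
    have h : (S.comp S').source q = x := mem_fib.1 hq
    exact Finset.mem_sigma.2 ⟨mem_fib.2 h, mem_fib.2 q.2.symm⟩
  · intro p hp
    have h : S.source p.1 = x := mem_fib.1 (Finset.mem_sigma.1 hp).1
    exact mem_fib.2 h
  · intro _ _
    rfl
  · intro _ _
    rfl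
  · intro _ _
    rfl

theorem sum_fib_congr {S S' : LFSpan.{u} X Y} (e : FibBij S S') (x : X) (F : S'.carrier → M) :
    ∑ q ∈ S.fib x, F (e.toEquiv q) = ∑ q ∈ S'.fib x, F q := by
  refine Finset.sum_equiv e.toEquiv (fun q => ?_) fun _ _ => rfl
  rw [mem_fib, mem_fib, e.source_comp]

theorem sum_fib_decomp {S : LFSpan.{u} X Y} {S' : LFSpan.{u} Y Z} {H : LFSpan.{u} X Z}
    (e : FibBij H (S.comp S')) (x : X) (F : S.carrier → S'.carrier → M) :
    ∑ q ∈ H.fib x, F (e.toEquiv q).1.1 (e.toEquiv q).1.2 =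
      ∑ a ∈ S.fib x, ∑ b ∈ S'.fib (S.target a), F a b := by
  rw [sum_fib_congr e x fun q => F q.1.1 q.1.2, sum_fib_comp]

open scoped Classical in
-- Two continuations of one `y` correspond to a pair `(s, t)` of composite elements whose first
-- components coincide. This is why agreement enters ∇d.
theorem sum_fib_decomp_decomp {Z' : Type u} {S : LFSpan.{u} X Y} {S₁ : LFSpan.{u} Y Z}
    {S₂ : LFSpan.{u} Y Z'} {H₁ : LFSpan.{u} X Z} {H₂ : LFSpan.{u} X Z'}
    (e₁ : FibBij H₁ (S.comp S₁)) (e₂ : FibBij H₂ (S.comp S₂)) (x : X)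
    (F : S₁.carrier → S₂.carrier → M) :
    ∑ y ∈ S.fib x, ∑ b ∈ S₁.fib (S.target y), ∑ c ∈ S₂.fib (S.target y), F b c =
      ∑ s ∈ H₁.fib x, ∑ t ∈ H₂.fib x, if (e₁.toEquiv s).1.1 = (e₂.toEquiv t).1.1 then
        F (e₁.toEquiv s).1.2 (e₂.toEquiv t).1.2 else 0 := by
  rw [sum_fib_decomp e₁ x fun a b => ∑ t ∈ H₂.fib x, if a = (e₂.toEquiv t).1.1 then
        F b (e₂.toEquiv t).1.2 else 0]
  refine Finset.sum_congr rfl fun a ha => Finset.sum_congr rfl fun b _ => ?_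
  rw [sum_fib_decomp e₂ x fun a' c => if a = a' then F b c else 0]
  rw [Finset.sum_eq_single_of_mem a ha]
  · exact Finset.sum_congr rfl fun c _ => (if_pos rfl).symm
  · intro a' _ hne
    exact Finset.sum_eq_zero fun c _ => if_neg hne.symm

theorem linearise_mapTarget_single (S : LFSpan.{u} X Y) (f : Y → Z) (x : X) :
    (S.mapTarget f).linearise (Finsupp.single x 1) =
      ∑ q ∈ S.fib x, Finsupp.single (f (S.target q)) 1 :=
  linearise_single _ _

theorem linearise_sum_single {ι : Type} [Fintype ι] (S : ι → LFSpan.{u} X Y) (x : X) :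
    (LFSpan.sum S).linearise (Finsupp.single x 1) =
      ∑ i, (S i).linearise (Finsupp.single x 1) := by
  have h : (LFSpan.sum S).fib x =
      (Finset.univ.sigma fun i => (S i).fib x : Finset (Σ i, (S i).carrier)) := by
    refine Finset.ext fun q => mem_fib.trans (Iff.trans ?_ Finset.mem_sigma.symm)
    exact (mem_fib (S := S q.1)).symm.trans (and_iff_right (Finset.mem_univ _)).symm
  simp only [linearise_single]
  rw [h]
  exact Finset.sum_sigma _ _ _

theorem linearise_sigma_single {ι : Type} {X : ι → Type u} {Y : Type u}
    (S : ∀ i, LFSpan.{u} (X i) Y) (i : ι) (x : X i) :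
    (LFSpan.sigma S).linearise (Finsupp.single ⟨i, x⟩ 1) =
      (S i).linearise (Finsupp.single x 1) := by
  rw [linearise_single, linearise_single]
  symm
  refine Finset.sum_bij (fun q _ => ⟨i, q⟩) ?_ ?_ ?_ fun _ _ => rfl
  · intro q hq
    rw [mem_fib] at hq
    exact mem_fib.2 (Sigma.ext rfl (heq_of_eq hq))
  · intro q _ q' _ h
    exact eq_of_heq (Sigma.mk.inj_iff.1 h).2
  · rintro ⟨j, q⟩ hq
    have h : (⟨j, (S j).source q⟩ : Σ i, X i) = ⟨i, x⟩ := mem_fib.1 hq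
    obtain ⟨rfl, h⟩ := Sigma.mk.inj_iff.1 h
    exact ⟨q, mem_fib.2 (eq_of_heq h), rfl⟩

theorem linearise_ofFun_comp_single (f : X → Y) (S : LFSpan.{u} Y Z) (x : X) :
    ((LFSpan.ofFun f).comp S).linearise (Finsupp.single x 1) =
      S.linearise (Finsupp.single (f x) 1) := by
  rw [linearise_single, linearise_single]
  refine (sum_fib_comp (LFSpan.ofFun f) S x fun _ b => Finsupp.single (S.target b) 1).trans ?_
  have : (LFSpan.ofFun f).fib x = ({x} : Finset X) :=
    Finset.ext fun y => mem_fib.trans Finset.mem_singleton.symm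
  rw [this]
  exact Finset.sum_singleton _ _

end LFSpan

/-! ### Reindexing iterated face sums by elements of composite faces. -/

namespace OrderedAugSemiSimplicialBurnside

open OrdFace

variable {X : OrderedAugSemiSimplicialBurnside.{u}} {i j k k' l m : ℕ}
variable {M : Type*} [AddCommMonoid M]

/-- The target of an element of a span, as a simplex. -/
def endpoint {f : Fin k ↪o Fin m} (s : (X.span f).carrier) : X.Simplex := ⟨k, (X.span f).target s⟩

theorem endpoint_mu_snd {f : Fin l ↪o Fin m} {g : Fin k ↪o Fin m} {e : Fin k ↪o Fin l}
    (he : e.trans f = g) (s : (X.span g).carrier) :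
    endpoint ((X.mu f e g he).toEquiv s).1.2 = endpoint s :=
  congrArg (Sigma.mk k) ((X.mu f e g he).target_comp s)

theorem sum_fib_of_miss_eq {f : Fin k ↪o Fin m} {g : Fin l ↪o Fin m} (h : miss f = miss g)
    (x : X.obj m) (φ : X.Simplex → M) :
    ∑ s ∈ (X.span f).fib x, φ (endpoint s) = ∑ s ∈ (X.span g).fib x, φ (endpoint s) := by
  obtain ⟨rfl, h'⟩ := Sigma.mk.inj_iff.1 (sigma_eq_of_miss_eq h)
  obtain rfl := eq_of_heq h'
  rfl

theorem face_insert_subset (U : Finset (Fin m)) (a : Fin m) :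
    miss (face U) ⊆ miss (face (insert a U)) := by
  rw [miss_face, miss_face]
  exact Finset.subset_insert _ _

theorem sum_face (U : Finset (Fin m)) (Φ : Fin m → M) :
    ∑ i : Fin (m - U.card), Φ (face U i) = ∑ a ∈ Uᶜ, Φ a := by
  have h : Uᶜ = Finset.univ.map (face U).toEmbedding := by
    conv_lhs => rw [← miss_face U]
    rw [miss, compl_compl]
  rw [h, Finset.sum_map]
  rfl

theorem miss_factor_insert (U : Finset (Fin m)) (i : Fin (m - U.card)) :
    miss (factor (face_insert_subset U (face U i))) = {i} := by
  have h := miss_trans (factor (face_insert_subset U (face U i))) (face U)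
  rw [factor_trans, miss_face, miss_face] at h
  ext w
  have hw : face U w ∉ U := missing_notMem _ _
  have h' := congrArg (fun S => face U w ∈ S) h
  simp [hw] at h'
  rw [Finset.mem_singleton, ← h']

/-- An element of ∂_U followed by a further face is, by μ, an element of ∂_{U ∪ a}, where `a` is the
vertex of the original simplex that the further face omits. -/
theorem sum_boundary_fixed (x : X.obj m) (U : Finset (Fin m))
    (F : (X.del U).carrier → X.Simplex → M) :
    ∑ s ∈ (X.del U).fib x, ∑ i : Fin (m - U.card),
        ∑ b ∈ (X.del {i}).fib ((X.del U).target s), F s (endpoint b) =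
      ∑ a ∈ Uᶜ, ∑ s ∈ (X.del (insert a U)).fib x,
        F (X.proj (face_insert_subset U a) s) (endpoint s) := by
  rw [Finset.sum_comm, ← sum_face]
  refine Finset.sum_congr rfl fun i _ => ?_
  have h := LFSpan.sum_fib_decomp (X.mu (face U) (factor (face_insert_subset U (face U i)))
    (face (insert (face U i) U)) (factor_trans _)) x fun s b => F s (endpoint b)
  simp only [endpoint_mu_snd] at h
  refine Eq.trans (Finset.sum_congr rfl fun s _ => ?_) h.symm
  exact sum_fib_of_miss_eq ((miss_face _).trans (miss_factor_insert U i).symm) _ (F s)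

theorem sum_insert_eq_sum_erase {α : Type*} [Fintype α] [DecidableEq α]
    {Φ Ψ : Finset α → α → M} (h : ∀ U a, a ∉ U → Φ U a = Ψ (insert a U) a) :
    ∑ U : Finset α, ∑ a ∈ Uᶜ, Φ U a = ∑ U : Finset α, ∑ a ∈ U, Ψ U a := by
  rw [Finset.sum_sigma', Finset.sum_sigma']
  refine Finset.sum_bij' (fun p _ => ⟨insert p.2 p.1, p.2⟩) (fun p _ => ⟨p.1.erase p.2, p.2⟩)
    ?_ ?_ ?_ ?_ ?_
  · rintro ⟨U, a⟩ _
    simp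
  · rintro ⟨U, a⟩ _
    simp
  · rintro ⟨U, a⟩ h
    simp only [Finset.mem_sigma, Finset.mem_univ, Finset.mem_compl, true_and] at h
    simp [Finset.erase_insert h]
  · rintro ⟨U, a⟩ h
    simp only [Finset.mem_sigma, Finset.mem_univ, true_and] at h
    simp [Finset.insert_erase h]
  · rintro ⟨U, a⟩ hU
    simp only [Finset.mem_sigma, Finset.mem_univ, Finset.mem_compl, true_and] at hU
    exact h U a hU

theorem sum_boundary (x : X.obj m)
    (F : ∀ U : Finset (Fin m), (X.del U).carrier → X.Simplex → M) :
    ∑ U : Finset (Fin m), ∑ s ∈ (X.del U).fib x, ∑ i : Fin (m - U.card),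
        ∑ b ∈ (X.del {i}).fib ((X.del U).target s), F U s (endpoint b) =
      ∑ U : Finset (Fin m), ∑ s ∈ (X.del U).fib x, ∑ a ∈ U,
        F (U.erase a) (X.proj (erase_face_subset U a) s) (endpoint s) := by
  simp only [sum_boundary_fixed]
  conv_rhs =>
    enter [2, U]
    rw [Finset.sum_comm]
  refine sum_insert_eq_sum_erase fun U a h => ?_
  refine Finset.sum_congr rfl fun s _ => ?_
  have key : ∀ (U' : Finset (Fin m)) (h1 : miss (face U) ⊆ miss (face (insert a U)))
      (h2 : miss (face U') ⊆ miss (face (insert a U))), U = U' →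
      F U (X.proj h1 s) (endpoint s) = F U' (X.proj h2 s) (endpoint s) := by
    rintro _ _ _ rfl
    rfl
  exact key _ _ _ (Finset.erase_insert h).symm

open scoped Classical in
-- Faces of the smaller ordinal correspond to the faces of the larger one that factor through `a`,
-- that is, to the subsets containing `miss a`.
theorem sum_finset_eq_sum_factor (a : Fin l ↪o Fin m) (Φ : ∀ k, (Fin k ↪o Fin l) → M) :
    ∑ U : Finset (Fin l), Φ _ (face U) =
      ∑ U : Finset (Fin m), if h : miss a ⊆ miss (face U) then Φ _ (factor h) else 0 := by
  have hdis : ∀ S : Finset (Fin l), Disjoint (miss a) (S.map a.toEmbedding) := by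
    intro S
    rw [Finset.disjoint_left]
    intro w h1 h2
    obtain ⟨j, _, rfl⟩ := Finset.mem_map.1 h2
    exact mem_miss.1 h1 j rfl
  have hU : ∀ U : Finset (Fin l), miss a ⊆ miss (face (miss a ∪ U.map a.toEmbedding)) := by
    intro U
    rw [miss_face]
    exact Finset.subset_union_left
  have hmiss : ∀ (U : Finset (Fin m)) (h : miss a ⊆ miss (face U)),
      miss a ∪ (miss (factor h)).map a.toEmbedding = U := by
    intro U h
    rw [← miss_trans, factor_trans, miss_face]
  have hcancel : ∀ U U' : Finset (Fin l),
      miss a ∪ U.map a.toEmbedding = miss a ∪ U'.map a.toEmbedding → U = U' := by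
    intro U U' h
    have h1 := congrArg (fun S => S \ miss a) h
    simp only [Finset.union_sdiff_left] at h1
    rw [(hdis U).symm.sdiff_eq_left, (hdis U').symm.sdiff_eq_left] at h1
    exact Finset.map_injective _ h1
  have hΦ : ∀ (k k' : ℕ) (f : Fin k ↪o Fin l) (g : Fin k' ↪o Fin l), miss f = miss g →
      Φ k f = Φ k' g := by
    intro k k' f g h
    obtain ⟨rfl, h'⟩ := Sigma.mk.inj_iff.1 (sigma_eq_of_miss_eq h)
    obtain rfl := eq_of_heq h'
    rfl
  rw [← Finset.sum_subset (Finset.subset_univ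
    (Finset.univ.filter fun U : Finset (Fin m) => miss a ⊆ miss (face U)))]
  · refine Finset.sum_bij (fun U _ => miss a ∪ U.map a.toEmbedding) ?_ ?_ ?_ ?_
    · intro U _
      exact Finset.mem_filter.2 ⟨Finset.mem_univ _, hU U⟩
    · intro U _ U' _ h
      exact hcancel U U' h
    · intro U h
      exact ⟨_, Finset.mem_univ _, hmiss U (Finset.mem_filter.1 h).2⟩
    · intro U _
      rw [dif_pos (hU U)]
      refine hΦ _ _ _ _ ((miss_face U).trans ?_)
      exact (hcancel _ _ (hmiss _ (hU U))).symm
  · intro U _ h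
    rw [dif_neg fun h' => h (Finset.mem_filter.2 ⟨Finset.mem_univ _, h'⟩)]

open scoped Classical in
theorem sum_link (x : X.obj m) (a : Fin l ↪o Fin m)
    (F : ∀ {k k' : ℕ} (f : Fin k ↪o Fin l) (g : Fin k' ↪o Fin l),
      (X.span f).carrier → (X.span g).carrier → M) :
    ∑ y ∈ (X.span a).fib x, ∑ U : Finset (Fin l), ∑ V : Finset (Fin l),
        ∑ s ∈ (X.del U).fib ((X.span a).target y), ∑ t ∈ (X.del V).fib ((X.span a).target y),
          F (face U) (face V) s t =
      ∑ U : Finset (Fin m), ∑ V : Finset (Fin m),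
        ∑ s ∈ (X.del U).fib x, ∑ t ∈ (X.del V).fib x,
          if h : X.AgreeAt s t a then
            F (factor h.1) (factor h.2.1)
              ((X.mu a (factor h.1) (face U) (factor_trans _)).toEquiv s).1.2
              ((X.mu a (factor h.2.1) (face V) (factor_trans _)).toEquiv t).1.2
          else 0 := by
  have h1 : ∀ y, ∑ U : Finset (Fin l), ∑ V : Finset (Fin l),
      ∑ s ∈ (X.del U).fib ((X.span a).target y), ∑ t ∈ (X.del V).fib ((X.span a).target y),
        F (face U) (face V) s t =
      ∑ U : Finset (Fin m), ∑ V : Finset (Fin m),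
        if h : miss a ⊆ miss (face U) ∧ miss a ⊆ miss (face V) then
          ∑ s ∈ (X.span (factor h.1)).fib ((X.span a).target y),
            ∑ t ∈ (X.span (factor h.2)).fib ((X.span a).target y),
              F (factor h.1) (factor h.2) s t else 0 := by
    intro y
    rw [sum_finset_eq_sum_factor a fun k f => ∑ V : Finset (Fin l),
      ∑ s ∈ (X.span f).fib ((X.span a).target y), ∑ t ∈ (X.del V).fib ((X.span a).target y),
        F f (face V) s t]
    refine Finset.sum_congr rfl fun U _ => ?_
    split_ifs with hU
    · rw [sum_finset_eq_sum_factor a fun k g =>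
        ∑ s ∈ (X.span (factor hU)).fib ((X.span a).target y),
          ∑ t ∈ (X.span g).fib ((X.span a).target y), F (factor hU) g s t]
      refine Finset.sum_congr rfl fun V _ => ?_
      by_cases hV : miss a ⊆ miss (face V)
      · rw [dif_pos hV, dif_pos ⟨hU, hV⟩]
      · rw [dif_neg hV, dif_neg fun h => hV h.2]
    · symm
      exact Finset.sum_eq_zero fun V _ => dif_neg fun h => hU h.1
  rw [Finset.sum_congr rfl fun y _ => h1 y, Finset.sum_comm]
  refine Finset.sum_congr rfl fun U _ => ?_
  rw [Finset.sum_comm]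
  refine Finset.sum_congr rfl fun V _ => ?_
  by_cases h : miss a ⊆ miss (face U) ∧ miss a ⊆ miss (face V)
  · simp only [dif_pos h]
    rw [LFSpan.sum_fib_decomp_decomp (X.mu a (factor h.1) (face U) (factor_trans _))
      (X.mu a (factor h.2) (face V) (factor_trans _))]
    refine Finset.sum_congr rfl fun s _ => Finset.sum_congr rfl fun t _ => ?_
    by_cases hst : X.AgreeAt s t a
    · rw [dif_pos hst]
      exact if_pos hst.2.2
    · rw [dif_neg hst]
      exact if_neg fun h' => hst ⟨h.1, h.2, h'⟩
  · simp only [dif_neg h, Finset.sum_const_zero]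
    symm
    refine Finset.sum_eq_zero fun s _ => Finset.sum_eq_zero fun t _ => dif_neg fun h' => h ?_
    exact ⟨h'.1, h'.2.1⟩

end OrderedAugSemiSimplicialBurnside

namespace OrderedAugSemiSimplicialBurnside

open OrdFace

variable {X : OrderedAugSemiSimplicialBurnside.{u}} {i j k k' l m : ℕ}

/-! ### The chain complex -/

theorem d_single (x : X.obj m) : X.d (Finsupp.single ⟨m, x⟩ 1) =
    ∑ i : Fin m, ∑ s ∈ (X.del {i}).fib x, Finsupp.single (endpoint s) 1 := by
  rw [d, LFSpan.linearise_sigma_single, LFSpan.linearise_sum_single]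
  exact Finset.sum_congr rfl fun i _ => LFSpan.linearise_mapTarget_single _ _ _

theorem d_endpoint {f : Fin k ↪o Fin m} (s : (X.span f).carrier) :
    X.d (Finsupp.single (endpoint s) 1) = ∑ i : Fin k,
      ∑ b ∈ (X.del {i}).fib ((X.span f).target s), Finsupp.single (endpoint b) 1 :=
  d_single _

theorem chainsHom_ext {M : Type*} [AddCommMonoid M] [Module (ZMod 2) M]
    {φ ψ : X.Chains →ₗ[ZMod 2] M}
    (h : ∀ (m : ℕ) (x : X.obj m), φ (Finsupp.single ⟨m, x⟩ 1) = ψ (Finsupp.single ⟨m, x⟩ 1)) :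
    φ = ψ :=
  Finsupp.lhom_ext' fun σ => LinearMap.ext_ring (h σ.1 σ.2)

/-- Both orders of omitting two vertices give the sum over the same span, that of the pair, so they
cancel modulo two. -/
theorem d_comp_d : X.d ∘ₗ X.d = 0 := by
  refine chainsHom_ext fun m x => ?_
  rw [LinearMap.comp_apply, d_single, LinearMap.zero_apply]
  simp only [map_sum, d_endpoint]
  rw [Finset.sum_congr rfl fun i _ => sum_boundary_fixed x {i}
    fun _ σ => (Finsupp.single σ 1 : X.Chains), Finset.sum_sigma']
  refine Finset.sum_involution (fun p _ => ⟨p.2, p.1⟩) ?_ ?_ ?_ ?_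
  · rintro ⟨a, b⟩ _
    simp only
    rw [Finset.pair_comm]
    exact ZModModule.add_self _
  · rintro ⟨a, b⟩ h _ heq
    simp only [Finset.mem_sigma, Finset.mem_univ, Finset.mem_compl, Finset.mem_singleton,
      true_and] at h
    exact h (congrArg Sigma.fst heq)
  · rintro ⟨a, b⟩ h
    simp only [Finset.mem_sigma, Finset.mem_univ, Finset.mem_compl, Finset.mem_singleton,
      true_and] at h ⊢
    exact Ne.symm h
  · rintro ⟨a, b⟩ _
    rfl

theorem chains_le_of_single {M : Type*} [AddCommMonoid M] [Module (ZMod 2) M]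
    (φ : X.Chains →ₗ[ZMod 2] M) (n : ℤ) (N : Submodule (ZMod 2) M)
    (h : ∀ (m : ℕ) (x : X.obj m), (m : ℤ) - 1 = n → φ (Finsupp.single ⟨m, x⟩ 1) ∈ N) :
    ∀ c ∈ X.chains n, φ c ∈ N := by
  suffices X.chains n ≤ N.comap φ from this
  rw [chains, Finsupp.supported_eq_span_single, Submodule.span_le]
  rintro _ ⟨σ, hσ, rfl⟩
  exact h σ.1 σ.2 hσ

theorem single_mem_chains {n : ℤ} (σ : X.Simplex) (h : (σ.1 : ℤ) - 1 = n) :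
    (Finsupp.single σ 1 : X.Chains) ∈ X.chains n :=
  Finsupp.single_mem_supported _ _ h

theorem chains_isInternal : DirectSum.IsInternal X.chains := by
  apply DirectSum.isInternal_submodule_of_iSupIndep_of_iSup_eq_top
  · intro n
    have h : (⨆ n', ⨆ (_ : n' ≠ n), X.chains n') = Finsupp.supported (ZMod 2) (ZMod 2)
        (⋃ n', ⋃ (_ : n' ≠ n), {σ : X.Simplex | (σ.1 : ℤ) - 1 = n'}) := by
      rw [Finsupp.supported_iUnion]
      refine iSup_congr fun n' => ?_
      by_cases hn : n' = n <;> simp [hn, chains]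
    rw [h]
    refine Finsupp.disjoint_supported_supported ?_
    rw [Set.disjoint_left]
    intro σ h h'
    simp only [Set.mem_iUnion, Set.mem_ofPred_eq] at h h'
    obtain ⟨n', hne, h'⟩ := h'
    exact hne (h'.symm.trans h)
  · have h : (⨆ n, X.chains n) = Finsupp.supported (ZMod 2) (ZMod 2)
        (⋃ n, {σ : X.Simplex | (σ.1 : ℤ) - 1 = n}) := by
      simp only [chains, Finsupp.supported_iUnion]
    rw [h, ← Finsupp.supported_univ]
    congr 1
    ext σ
    simp

theorem isChainComplex : StableSymmetric.IsChainComplex X.chains X.d where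
  isInternal := chains_isInternal
  degree n := by
    refine chains_le_of_single _ _ _ fun m x hm => ?_
    rw [d_single]
    refine Submodule.sum_mem _ fun i _ => Submodule.sum_mem _ fun s _ => ?_
    refine single_mem_chains _ ?_
    have hi := i.pos
    simp only [endpoint, Finset.card_singleton]
    omega
  d_comp_d := d_comp_d

/-! ### The operations -/

theorem sum_fib_wedge {M : Type*} [AddCommMonoid M] (U V : Finset (Fin m)) (x y : X.obj m)
    (F : (X.del U).carrier → (X.del V).carrier → M) :
    ∑ q ∈ (X.wedge U V).fib (x, y), F q.1.1 q.1.2 =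
      ∑ s ∈ (X.del U).fib x, ∑ t ∈ (X.del V).fib y, Nat.card (X.PositiveChains s t) • F s t := by
  have (st : (X.del U).carrier × (X.del V).carrier) : Fintype (X.PositiveChains st.1 st.2) :=
    Fintype.ofFinite _
  have h : (X.wedge U V).fib (x, y) =
      ((X.del U).fib x ×ˢ (X.del V).fib y).sigma fun st =>
        (Finset.univ : Finset (X.PositiveChains st.1 st.2)) := by
    refine Finset.ext fun q => LFSpan.mem_fib.trans (Iff.trans ?_ Finset.mem_sigma.symm)
    refine Prod.mk_inj.trans (Iff.trans ?_ (and_iff_left (Finset.mem_univ _)).symm)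
    rw [Finset.mem_product, LFSpan.mem_fib, LFSpan.mem_fib]
  rw [h]
  refine (Finset.sum_sigma _ _ _).trans ?_
  rw [Finset.sum_product]
  refine Finset.sum_congr rfl fun s _ => Finset.sum_congr rfl fun t _ => ?_
  refine (Finset.sum_const (F s t)).trans ?_
  rw [Finset.card_univ, @Nat.card_eq_fintype_card _ (this (s, t))]

/-- The tensor product of two simplices. -/
noncomputable def simplexTmul (σ τ : X.Simplex) : X.Chains ⊗[ZMod 2] X.Chains :=
  Finsupp.single σ 1 ⊗ₜ Finsupp.single τ 1

/-- The sum of the targets of all pairs `(s, t)` over `x` of total codimension `q`, with given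
coefficients. -/
noncomputable def pairSum (x : X.obj m) (q : ℤ)
    (c : ∀ U V : Finset (Fin m), (X.del U).carrier → (X.del V).carrier → ZMod 2) :
    X.Chains ⊗[ZMod 2] X.Chains :=
  ∑ U : Finset (Fin m), ∑ V : Finset (Fin m), ∑ s ∈ (X.del U).fib x, ∑ t ∈ (X.del V).fib x,
    (if (U.card : ℤ) + V.card = q then c U V s t else 0) • simplexTmul (endpoint s) (endpoint t)

/-- Sequences become admissible pairs, and the number of positive chains over `(s, t)` matters only
modulo two. The diagonal ensures that `s` and `t` have the common source required by
`card_positiveChains`. -/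
theorem nabla_single (n : ℤ) (x : X.obj m) : X.nabla n (Finsupp.single ⟨m, x⟩ 1) =
    pairSum x ((m : ℤ) - 1 - n) fun _ _ s t => weight s t := by
  classical
  have := Fintype.ofFinite {U : TwiceSeq m // (U.length : ℤ) = (m : ℤ) - 1 - n}
  have h1 : X.nabla n (Finsupp.single ⟨m, x⟩ 1) =
      ∑ W : {W : TwiceSeq m // (W.length : ℤ) = (m : ℤ) - 1 - n},
        ∑ q ∈ (X.wedge W.1.minus W.1.plus).fib (x, x),
          simplexTmul (endpoint q.1.1) (endpoint q.1.2) := by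
    rw [nabla, LinearMap.comp_apply, LFSpan.linearise_sigma_single,
      LFSpan.linearise_ofFun_comp_single, nablaSpan, LFSpan.linearise_sum_single, map_sum]
    refine Finset.sum_congr rfl fun W _ => ?_
    rw [LFSpan.linearise_mapTarget_single, map_sum]
    refine Finset.sum_congr rfl fun q _ => ?_
    exact finsuppTensorFinsupp'_symm_single_eq_single_one_tmul _ _ _ _ _
  rw [h1, TwiceSeq.sum_length_eq ((m : ℤ) - 1 - n) fun U V =>
    ∑ q ∈ (X.wedge U V).fib (x, x), simplexTmul (endpoint q.1.1) (endpoint q.1.2), pairSum]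
  refine Finset.sum_congr rfl fun U _ => Finset.sum_congr rfl fun V _ => ?_
  rw [sum_fib_wedge U V x x fun s t => simplexTmul (endpoint s) (endpoint t)]
  by_cases h : Admissible U V ∧ (U.card : ℤ) + V.card = (m : ℤ) - 1 - n
  · rw [if_pos h]
    refine Finset.sum_congr rfl fun s hs => Finset.sum_congr rfl fun t ht => ?_
    rw [if_pos h.2, weight_face, if_pos h.1, ← card_positiveChains s t
      ((LFSpan.mem_fib.1 hs).trans (LFSpan.mem_fib.1 ht).symm), Nat.cast_smul_eq_nsmul]
  · rw [if_neg h]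
    symm
    refine Finset.sum_eq_zero fun s _ => Finset.sum_eq_zero fun t _ => ?_
    rw [weight_face]
    split_ifs with h1 h2
    · exact absurd ⟨h2, h1⟩ h
    · exact zero_smul _ _
    · exact zero_smul _ _

theorem nabla_degree (p n : ℤ) : ∀ c ∈ X.chains n,
    X.nabla p c ∈ StableSymmetric.tensorGrading X.chains (n + p) := by
  refine chains_le_of_single _ _ _ fun m x hm => ?_
  rw [nabla_single, pairSum]
  refine Submodule.sum_mem _ fun U _ => Submodule.sum_mem _ fun V _ =>
    Submodule.sum_mem _ fun s _ => Submodule.sum_mem _ fun t _ => ?_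
  split_ifs with h
  swap
  · rw [zero_smul]
    exact Submodule.zero_mem _
  refine Submodule.smul_mem _ _ ?_
  have hU := sub_add_card U
  have hV := sub_add_card V
  refine Submodule.mem_iSup_of_mem (((m - U.card : ℕ) : ℤ) - 1)
    (Submodule.mem_iSup_of_mem (((m - V.card : ℕ) : ℤ) - 1)
      (Submodule.mem_iSup_of_mem (by omega) ?_))
  exact ⟨⟨_, single_mem_chains (endpoint s) rfl⟩ ⊗ₜ ⟨_, single_mem_chains (endpoint t) rfl⟩, rfl⟩

theorem pairSum_add (x : X.obj m) (q : ℤ)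
    (c c' : ∀ U V : Finset (Fin m), (X.del U).carrier → (X.del V).carrier → ZMod 2) :
    pairSum x q c + pairSum x q c' = pairSum x q fun U V s t => c U V s t + c' U V s t := by
  simp only [pairSum, ← Finset.sum_add_distrib, ← add_smul]
  refine Finset.sum_congr rfl fun U _ => Finset.sum_congr rfl fun V _ =>
    Finset.sum_congr rfl fun s _ => Finset.sum_congr rfl fun t _ => ?_
  split_ifs
  · rfl
  · rw [add_zero]

theorem twist_pairSum (x : X.obj m) (q : ℤ) :
    StableSymmetric.twist (pairSum x q fun _ _ s t => weight s t) =
      pairSum x q fun _ _ s t => weight t s := by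
  simp only [pairSum, map_sum, map_smul]
  rw [Finset.sum_comm]
  refine Finset.sum_congr rfl fun U _ => Finset.sum_congr rfl fun V _ => ?_
  rw [Finset.sum_comm]
  refine Finset.sum_congr rfl fun s _ => Finset.sum_congr rfl fun t _ => ?_
  rw [add_comm (V.card : ℤ)]
  rfl

theorem sum_sum_comm₄ {M : Type*} [AddCommMonoid M] (x : X.obj m)
    (F : ∀ U V : Finset (Fin m), (X.del U).carrier → (X.del V).carrier → M) :
    ∑ U : Finset (Fin m), ∑ V : Finset (Fin m), ∑ s ∈ (X.del U).fib x, ∑ t ∈ (X.del V).fib x,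
      F U V s t = ∑ V : Finset (Fin m), ∑ t ∈ (X.del V).fib x, ∑ U : Finset (Fin m),
        ∑ s ∈ (X.del U).fib x, F U V s t := by
  rw [Finset.sum_comm]
  refine Finset.sum_congr rfl fun V _ => ?_
  rw [Finset.sum_comm]
  exact Finset.sum_congr rfl fun U _ => Finset.sum_comm

theorem sum_ite_card_erase (U : Finset (Fin m)) (p q : ℤ) (w : Fin m → ZMod 2) :
    (∑ a ∈ U, if ((U.erase a).card : ℤ) + p = q then w a else 0) =
      if (U.card : ℤ) + p = q + 1 then ∑ a ∈ U, w a else 0 := by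
  have h : ∀ a ∈ U, (((U.erase a).card : ℤ) + p = q ↔ (U.card : ℤ) + p = q + 1) := by
    intro a ha
    have := Finset.card_erase_add_one ha
    omega
  rw [Finset.sum_congr rfl fun a ha => if_congr (h a ha) rfl rfl]
  split_ifs
  · rfl
  · exact Finset.sum_const_zero

theorem map_d_id_pairSum (x : X.obj m) (q : ℤ) :
    TensorProduct.map X.d LinearMap.id (pairSum x q fun _ _ s t => weight s t) =
      pairSum x (q + 1) fun U _ s t => ∑ a ∈ U, weight (X.proj (erase_face_subset U a) s) t := by
  simp only [pairSum, map_sum, map_smul, simplexTmul, TensorProduct.map_tmul, d_endpoint,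
    LinearMap.id_apply, TensorProduct.sum_tmul]
  rw [sum_sum_comm₄, sum_sum_comm₄]
  refine Finset.sum_congr rfl fun V _ => Finset.sum_congr rfl fun t _ => ?_
  simp only [Finset.smul_sum]
  rw [sum_boundary x fun U s σ => (if (U.card : ℤ) + V.card = q then weight s t else 0) •
    ((Finsupp.single σ 1 : X.Chains) ⊗ₜ[ZMod 2] (Finsupp.single (endpoint t) 1 : X.Chains))]
  refine Finset.sum_congr rfl fun U _ => Finset.sum_congr rfl fun s _ => ?_
  rw [← Finset.sum_smul, sum_ite_card_erase]

theorem map_id_d_pairSum (x : X.obj m) (q : ℤ) :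
    TensorProduct.map LinearMap.id X.d (pairSum x q fun _ _ s t => weight s t) =
      pairSum x (q + 1) fun _ V s t => ∑ a ∈ V, weight s (X.proj (erase_face_subset V a) t) := by
  simp only [pairSum, map_sum, map_smul, simplexTmul, TensorProduct.map_tmul, d_endpoint,
    LinearMap.id_apply, TensorProduct.tmul_sum]
  refine Finset.sum_congr rfl fun U _ => ?_
  refine Finset.sum_comm.trans (Eq.trans ?_ Finset.sum_comm)
  refine Finset.sum_congr rfl fun s _ => ?_
  simp only [Finset.smul_sum]
  rw [sum_boundary x fun V t σ => (if (U.card : ℤ) + V.card = q then weight s t else 0) •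
    ((Finsupp.single (endpoint s) 1 : X.Chains) ⊗ₜ[ZMod 2] (Finsupp.single σ 1 : X.Chains))]
  refine Finset.sum_congr rfl fun V _ => Finset.sum_congr rfl fun t _ => ?_
  rw [← Finset.sum_smul]
  simp only [add_comm (U.card : ℤ)]
  rw [sum_ite_card_erase]

theorem card_miss_factor {a : Fin l ↪o Fin m} {g : Fin k ↪o Fin m} (h : miss a ⊆ miss g) :
    (miss g).card = (miss a).card + (miss (factor h)).card := by
  have h1 := add_card_miss a
  have h2 := add_card_miss g
  have h3 := add_card_miss (factor h)
  omega

theorem nabla_d_single (n : ℤ) (x : X.obj m) : X.nabla n (X.d (Finsupp.single ⟨m, x⟩ 1)) =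
    pairSum x ((m : ℤ) - 1 - n + 1) fun _ _ s t => ∑ a : Fin m, linkWeight s t (face {a}) := by
  classical
  rw [d_single]
  simp only [map_sum]
  have h1 : ∀ a : Fin m, ∑ y ∈ (X.del {a}).fib x, X.nabla n (Finsupp.single (endpoint y) 1) =
      ∑ U : Finset (Fin m), ∑ V : Finset (Fin m), ∑ s ∈ (X.del U).fib x, ∑ t ∈ (X.del V).fib x,
        (if (U.card : ℤ) + V.card = (m : ℤ) - 1 - n + 1 then linkWeight s t (face {a}) else 0) •
          simplexTmul (endpoint s) (endpoint t) := by
    intro a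
    have h := sum_link x (face {a}) fun f g s t =>
      (if ((miss f).card : ℤ) + (miss g).card =
        ((m - ({a} : Finset (Fin m)).card : ℕ) : ℤ) - 1 - n then weight s t else 0) •
        simplexTmul (X := X) (endpoint s) (endpoint t)
    simp only [miss_face] at h
    refine (Finset.sum_congr rfl fun y _ => nabla_single n ((X.del {a}).target y)).trans
      (h.trans ?_)
    refine Finset.sum_congr rfl fun U _ => Finset.sum_congr rfl fun V _ =>
      Finset.sum_congr rfl fun s _ => Finset.sum_congr rfl fun t _ => ?_
    unfold linkWeight
    by_cases hst : X.AgreeAt s t (face {a})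
    · have hU := card_miss_factor hst.1
      have hV := card_miss_factor hst.2.1
      simp only [miss_face, Finset.card_singleton] at hU hV
      have hm := a.pos
      -- Both codimensions drop by one in the link, while its degree is one less; hence the net `+
      -- 1`.
      have hiff : ((miss (factor hst.1)).card : ℤ) + (miss (factor hst.2.1)).card =
          ((m - ({a} : Finset (Fin m)).card : ℕ) : ℤ) - 1 - n ↔
          (U.card : ℤ) + V.card = (m : ℤ) - 1 - n + 1 := by
        have h1 := Finset.card_singleton a
        omega
      rw [dif_pos hst, dif_pos hst, if_congr hiff rfl rfl, endpoint_mu_snd, endpoint_mu_snd]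
    · rw [dif_neg hst, dif_neg hst, ite_self, zero_smul]
  rw [Finset.sum_congr rfl fun a _ => h1 a, pairSum]
  refine Finset.sum_comm.trans (Finset.sum_congr rfl fun U _ => ?_)
  refine Finset.sum_comm.trans (Finset.sum_congr rfl fun V _ => ?_)
  refine Finset.sum_comm.trans (Finset.sum_congr rfl fun s _ => ?_)
  refine Finset.sum_comm.trans (Finset.sum_congr rfl fun t _ => ?_)
  rw [← Finset.sum_smul]
  split_ifs
  · rfl
  · rw [Finset.sum_const_zero]

theorem isComultiplication : StableSymmetric.IsComultiplication X.chains X.d X.nabla where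
  degree := nabla_degree
  nabla_comp_d n := by
    refine chainsHom_ext fun m x => ?_
    simp only [LinearMap.comp_apply, LinearMap.add_apply, LinearMap.id_apply,
      StableSymmetric.tensorD]
    rw [nabla_d_single, nabla_single, nabla_single, map_d_id_pairSum, map_id_d_pairSum,
      twist_pairSum, show (m : ℤ) - 1 - (n - 1) = m - 1 - n + 1 by ring, pairSum_add, pairSum_add,
      pairSum_add]
    congr 1
    funext U V s t
    -- Every term is now a `pairSum` of codimension `m - 1 - n + 1`, so coefficients can be
    -- compared; signs disappear in characteristic two.
    have h := sum_weight_eq_zero s t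
    rw [add_eq_zero_iff_eq_neg, ZModModule.neg_eq_self] at h
    exact h.symm

end OrderedAugSemiSimplicialBurnside

/-! ### Duality -/

namespace StableSymmetric

variable {C : Type*} [AddCommGroup C] [Module (ZMod 2) C] {gr : ℤ → Submodule (ZMod 2) C}
  {d : C →ₗ[ZMod 2] C}

theorem IsChainComplex.isCochainComplex (h : IsChainComplex gr d) :
    IsCochainComplex (cochains gr) d.dualMap where
  independent p := by
    rw [Submodule.disjoint_def]
    intro α hα hα'
    have hp : ∀ c ∈ gr p, α c = 0 := by
      -- Cochains of other degrees vanish on `gr p`, and `α` of degree `p` vanishes on all other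
      -- summands; hence `α` is zero.
      have hle : (⨆ q, ⨆ (_ : q ≠ p), cochains gr q) ≤ (gr p).dualAnnihilator := by
        refine iSup₂_le fun q hq β hβ => ?_
        rw [Submodule.mem_dualAnnihilator]
        exact hβ p hq.symm
      exact (Submodule.mem_dualAnnihilator _).1 (hle hα')
    have htop : (⊤ : Submodule (ZMod 2) C) ≤ LinearMap.ker α := by
      rw [← h.isInternal.submodule_iSup_eq_top]
      refine iSup_le fun n c hc => ?_
      by_cases hn : n = p
      · exact hp c (hn ▸ hc)
      · exact hα n hn c hc
    exact LinearMap.ext fun c => htop (Submodule.mem_top (x := c))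
  degree p α hα n hn c hc := hα (n - 1) (by omega) _ (h.degree n c hc)
  δ_comp_δ := by
    refine LinearMap.ext fun α => LinearMap.ext fun c => ?_
    have hc : d (d c) = 0 := LinearMap.congr_fun h.d_comp_d c
    simp [hc]

theorem dualDistrib_eq_zero {p q n : ℤ} (hn : n ≠ p + q) {α β : Module.Dual (ZMod 2) C}
    (hα : α ∈ cochains gr p) (hβ : β ∈ cochains gr q) :
    ∀ z ∈ tensorGrading gr n, TensorProduct.dualDistrib (ZMod 2) C C (α ⊗ₜ β) z = 0 := by
  suffices tensorGrading gr n ≤ LinearMap.ker (TensorProduct.dualDistrib (ZMod 2) C C (α ⊗ₜ β))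
    from this
  refine iSup_le fun p' => iSup_le fun q' => iSup_le fun h => ?_
  rintro _ ⟨z, rfl⟩
  rw [LinearMap.mem_ker]
  induction z using TensorProduct.induction_on with
  | zero => simp
  | add z w hz hw => rw [map_add, map_add, hz, hw, add_zero]
  | tmul a b =>
    rw [TensorProduct.map_tmul, TensorProduct.dualDistrib_apply]
    by_cases hp : p' = p
    · have hq : q' ≠ q := by omega
      rw [Submodule.subtype_apply, Submodule.subtype_apply, hβ q' hq b b.2, mul_zero]
    · rw [Submodule.subtype_apply, Submodule.subtype_apply, hα p' hp a a.2, zero_mul]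

theorem dualDistrib_tensorD (α β : Module.Dual (ZMod 2) C) (z : C ⊗[ZMod 2] C) :
    TensorProduct.dualDistrib (ZMod 2) C C (α ⊗ₜ β) (tensorD d z) =
      TensorProduct.dualDistrib (ZMod 2) C C (d.dualMap α ⊗ₜ β) z +
        TensorProduct.dualDistrib (ZMod 2) C C (α ⊗ₜ d.dualMap β) z := by
  induction z using TensorProduct.induction_on with
  | zero => simp
  | add z w hz hw =>
    rw [map_add, map_add, hz, hw, map_add, map_add]
    ring
  | tmul a b => simp [tensorD]

theorem dualDistrib_twist (α β : Module.Dual (ZMod 2) C) (z : C ⊗[ZMod 2] C) :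
    TensorProduct.dualDistrib (ZMod 2) C C (α ⊗ₜ β) (twist z) =
      TensorProduct.dualDistrib (ZMod 2) C C (β ⊗ₜ α) z := by
  induction z using TensorProduct.induction_on with
  | zero => simp
  | add z w hz hw => rw [map_add, map_add, hz, hw, map_add]
  | tmul a b => simp [twist, mul_comm]

/-- Evaluating α ⊗ β on the identity for ∇ moves d ⊗ 1 + 1 ⊗ d and T across the pairing. The product
vanishes outside degree `p + q - i` because ∇_i raises degree by `i`. -/
theorem IsComultiplication.isMultiplication {nabla : ℤ → C →ₗ[ZMod 2] C ⊗[ZMod 2] C}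
    (h : IsComultiplication gr d nabla) :
    IsMultiplication (cochains gr) d.dualMap fun i => dualOperation (nabla i) where
  degree i p q α hα β hβ n hn c hc :=
    dualDistrib_eq_zero (n := n + i) (by omega) hα hβ _ (h.degree i n c hc)
  δ_cup i p q α _ β _ := by
    refine LinearMap.ext fun c => ?_
    have hc := LinearMap.congr_fun (h.nabla_comp_d i) c
    simp only [LinearMap.comp_apply, LinearMap.add_apply, LinearMap.id_apply] at hc
    simp only [dualOperation, LinearMap.comp_apply, LinearMap.dualMap_apply, LinearMap.add_apply]
    rw [hc, map_add, map_add, dualDistrib_tensorD, dualDistrib_twist, ← add_assoc]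

end StableSymmetric

theorem theorem3 (X : OrderedAugSemiSimplicialBurnside.{u}) :
    StableSymmetric.IsChainComplex X.chains X.d ∧
    StableSymmetric.IsComultiplication X.chains X.d X.nabla ∧
    StableSymmetric.IsCochainComplex (StableSymmetric.cochains X.chains) X.d.dualMap ∧
    StableSymmetric.IsMultiplication (StableSymmetric.cochains X.chains) X.d.dualMap
      (fun i => StableSymmetric.dualOperation (X.nabla i)) :=
  ⟨OrderedAugSemiSimplicialBurnside.isChainComplex,
    OrderedAugSemiSimplicialBurnside.isComultiplication,
    OrderedAugSemiSimplicialBurnside.isChainComplex.isCochainComplex,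
    OrderedAugSemiSimplicialBurnside.isComultiplication.isMultiplication⟩
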